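/- Let $(\mathcal Y,\mathcal A)$ be a measurable space and let $\mathcal W$ be a non-empty set of probability measures on it. Let $\mathcal P(\mathcal W)$ be the set of probability mass functions $P$ on $\mathcal W$ with finite support; sums and products over $W$ below range over the $W$ with $P(W)>0$. For $\alpha\in[0,\infty]$ and $P\in\mathcal P(\mathcal W)$, the order $\alpha$ mean measure $\mu_{\alpha,P}$ is defined, for any $\sigma$-finite reference measure $\nu$ dominating the support of $P$ (the choice does not matter), by $$\frac{d\mu_{\alpha,P}}{d\nu}=\begin{cases}\prod_W\left(\frac{dW}{d\nu}\right)^{P(W)}&\alpha=0,\\ \left(\sum_W P(W)\left(\frac{dW}{d\nu}\right)^{\alpha}\right)^{1/\alpha}&\alpha\in(0,\infty),\\ \max_W\frac{dW}{d\nu}&\alpha=\infty.\end{cases}$$ Write $\|\mu_{\alpha,P}\|=\mu_{\alpha,P}(\mathcal Y)$ and $p_1(W|y)=P(W)\frac{dW}{d\mu_{1,P}}(y)$. The order $\alpha$ Rényi information is $$I_\alpha(P)=\begin{cases}\operatorname{ess\,inf}_{\mu_{1,P}}\ln\frac{1}{\sum_W \mathbf 1\{p_1(W|y)>0\}P(W)}&\alpha=0,\\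 \frac{\alpha}{\alpha-1}\ln\|\mu_{\alpha,P}\|&\alpha\in(0,\infty)\setminus\{1\},\\ \int\sum_W p_1(W|y)\ln\frac{p_1(W|y)}{P(W)}\,\mu_{1,P}(dy)&\alpha=1,\\ \ln\|\mu_{\infty,P}\|&\alpha=\infty,\end{cases}$$ and the order $\alpha$ Rényi capacity is $C_\alpha(\mathcal W)=\sup_{P\in\mathcal P(\mathcal W)}I_\alpha(P)$, an extended real number. Then: (a) $C_\alpha(\mathcal W)$ is nondecreasing and lower semicontinuous in $\alpha$ on $[0,\infty]$. (b) There is a countable $\mathcal W'\subseteq\mathcal W$ with $C_\alpha(\mathcal W')=C_\alpha(\mathcal W)$ for all $\alpha\in[0,\infty]$. (c) $\frac{1-\alpha}{\alpha}C_\alpha(\mathcal W)$ is nonincreasing and continuous in $\alpha$ on $(0,1)$, and $C_\alpha(\mathcal W)$ is continuous in $\alpha$ on $(0,1]$ (as extended real valued functions). (d) $(\alpha-1)C_\alpha(\mathcal W)$ is convex in $\alpha$ on $(1,\infty)$ (as an extended real valued function). (e) If $C_\vartheta(\mathcal W)<\infty$ for some $\vartheta\in(0,1)$, then $C_\alpha(\mathcal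 W)$ is finite for all $\alpha\in[0,1)$. (f) If $C_\vartheta(\mathcal W)<\infty$ for some $\vartheta\in(0,\infty]$, then $C_\alpha(\mathcal W)$ is nondecreasing and continuous in $\alpha$ on $(0,\vartheta]$. (g) If $C_\vartheta(\mathcal W)<\infty$ for some $\vartheta\in(0,\infty]$, then for every $\epsilon>0$ there is a finite $\mathcal W'\subseteq\mathcal W$ such that $C_\alpha(\mathcal W')>C_\alpha(\mathcal W)-\epsilon$ for all $\alpha\in[\epsilon,\vartheta]$. (h) Either $C_\alpha(\mathcal W)$ is continuous in $\alpha$ on $(0,\infty]$, or there is a $\phi\in[1,\infty)$ such that $C_\alpha(\mathcal W)$ is bounded above and continuous in $\alpha$ on $(0,\phi]$ and infinite on $(\phi,\infty]$, and $\phi$ is its only discontinuity on $(0,\infty]$. -/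

import Mathlib

open MeasureTheory Set Filter Topology
open scoped ENNReal NNReal

namespace Renyi

noncomputable section

variable {Ω : Type*} [MeasurableSpace Ω]

/-- The probability mass functions on `𝒲` with finite support: finitely supported weights on
probability measures, summing to one, all of whose support lies in `𝒲`. -/
def priors (𝒲 : Set (ProbabilityMeasure Ω)) : Set (ProbabilityMeasure Ω →₀ ℝ≥0) :=
  {P | ∑ W ∈ P.support, P W = 1 ∧ (P.support : Set (ProbabilityMeasure Ω)) ⊆ 𝒲}

/-- The order `α` weighted mean, for the prior `P`, of the Radon-Nikodym derivatives with respect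
to a reference measure `ν`. -/
def meanDensity (α : ℝ≥0∞) (P : ProbabilityMeasure Ω →₀ ℝ≥0) (ν : Measure Ω) (y : Ω) : ℝ≥0∞ :=
  if α = 0 then ∏ W ∈ P.support, ((W : Measure Ω).rnDeriv ν y) ^ (P W : ℝ)
  else if α = ∞ then P.support.sup fun W => (W : Measure Ω).rnDeriv ν y
  else (∑ W ∈ P.support, (P W : ℝ≥0∞) * ((W : Measure Ω).rnDeriv ν y) ^ α.toReal) ^ (1 / α.toReal)

/-- The mixture `∑ P(W) W`, a finite measure dominating every `W` with `P(W) > 0`. -/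
def mixture (P : ProbabilityMeasure Ω →₀ ℝ≥0) : Measure Ω :=
  ∑ W ∈ P.support, P W • (W : Measure Ω)

/-- The order `α` mean measure for the prior `P`. The mixture serves as the reference measure;
`meanMeasure_eq_withDensity` shows that every other reference measure gives the same result. -/
def meanMeasure (α : ℝ≥0∞) (P : ProbabilityMeasure Ω →₀ ℝ≥0) : Measure Ω :=
  (mixture P).withDensity (meanDensity α P (mixture P))

/-- The order one posterior `P(W) dW/dμ₁`, where `μ₁` is the order one mean measure. -/
def posterior (P : ProbabilityMeasure Ω →₀ ℝ≥0) (W : ProbabilityMeasure Ω) (y : Ω) : ℝ≥0∞ :=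
  (P W : ℝ≥0∞) * (W : Measure Ω).rnDeriv (meanMeasure 1 P) y

open Classical in
/-- The order `α` Rényi information for the prior `P`. -/
def information (α : ℝ≥0∞) (P : ProbabilityMeasure Ω →₀ ℝ≥0) : EReal :=
  if α = 0 then
    essInf (fun y => ENNReal.log
      (1 / ∑ W ∈ P.support, if 0 < posterior P W y then (P W : ℝ≥0∞) else 0)) (meanMeasure 1 P)
  else if α = 1 then
    ((∫ y, ∑ W ∈ P.support,
      (posterior P W y).toReal * Real.log ((posterior P W y).toReal / P W)
        ∂(meanMeasure 1 P) : ℝ) : EReal)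
  else if α = ∞ then ENNReal.log (meanMeasure ∞ P univ)
  else ((α.toReal / (α.toReal - 1) : ℝ) : EReal) * ENNReal.log (meanMeasure α P univ)

/-- The order `α` Rényi capacity of a set of probability measures. -/
def capacity (α : ℝ≥0∞) (𝒲 : Set (ProbabilityMeasure Ω)) : EReal :=
  ⨆ P ∈ priors 𝒲, information α P

instance (P : ProbabilityMeasure Ω →₀ ℝ≥0) : IsFiniteMeasure (mixture P) := by
  refine ⟨?_⟩
  simp only [mixture, Measure.coe_finsetSum, Finset.sum_apply, Measure.smul_apply]
  refine ENNReal.sum_lt_top.2 fun W _ => ?_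
  simp [ENNReal.smul_def]

lemma absolutelyContinuous_mixture (P : ProbabilityMeasure Ω →₀ ℝ≥0) {W : ProbabilityMeasure Ω}
    (hW : W ∈ P.support) : (W : Measure Ω) ≪ mixture P := by
  refine Measure.AbsolutelyContinuous.mk fun s _ hs => ?_
  simp only [mixture, Measure.coe_finsetSum, Finset.sum_apply, Measure.smul_apply,
    Finset.sum_eq_zero_iff] at hs
  have h := hs W hW
  simp only [ENNReal.smul_def, smul_eq_mul, mul_eq_zero, ENNReal.coe_eq_zero] at h
  exact h.resolve_left (Finsupp.mem_support_iff.1 hW)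

lemma mixture_absolutelyContinuous {P : ProbabilityMeasure Ω →₀ ℝ≥0} {ν : Measure Ω}
    (hν : ∀ W ∈ P.support, (W : Measure Ω) ≪ ν) : mixture P ≪ ν := by
  refine Measure.AbsolutelyContinuous.mk fun s _ hs => ?_
  simp only [mixture, Measure.coe_finsetSum, Finset.sum_apply, Measure.smul_apply]
  exact Finset.sum_eq_zero fun W hW => by simp [hν W hW hs]

lemma measurable_meanDensity (α : ℝ≥0∞) (P : ProbabilityMeasure Ω →₀ ℝ≥0) (ν : Measure Ω) :
    Measurable (meanDensity α P ν) := by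
  unfold meanDensity
  split_ifs
  · exact Finset.measurable_prod _ fun W _ => (Measure.measurable_rnDeriv _ _).pow_const _
  · simp only [Finset.sup_eq_iSup]
    exact Measurable.biSup _ P.support.countable_toSet
      fun W _ => Measure.measurable_rnDeriv _ _
  · exact (Finset.measurable_sum _ fun W _ =>
      ((Measure.measurable_rnDeriv _ _).pow_const _).const_mul _).pow_const _

/-- The mean measure does not depend on the reference measure used to define it. -/
theorem meanMeasure_eq_withDensity (α : ℝ≥0∞) {P : ProbabilityMeasure Ω →₀ ℝ≥0}
    (hP : ∑ W ∈ P.support, P W = 1) (ν : Measure Ω) [SigmaFinite ν]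
    (hν : ∀ W ∈ P.support, (W : Measure Ω) ≪ ν) :
    meanMeasure α P = ν.withDensity (meanDensity α P ν) := by
  have hm := mixture_absolutelyContinuous hν
  have key : meanDensity α P ν =ᵐ[ν]
      (mixture P).rnDeriv ν * meanDensity α P (mixture P) := by
    have h1 : ∀ᵐ y ∂ν, ∀ W ∈ P.support, (W : Measure Ω).rnDeriv ν y =
        (W : Measure Ω).rnDeriv (mixture P) y * (mixture P).rnDeriv ν y := by
      refine (Finset.eventually_all P.support).2 fun W hW => ?_
      filter_upwards [Measure.rnDeriv_mul_rnDeriv (κ := ν) (absolutelyContinuous_mixture P hW)]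
        with y hy
      simpa using hy.symm
    filter_upwards [h1, (mixture P).rnDeriv_ne_top ν] with y hy hc
    simp only [Pi.mul_apply, meanDensity]
    generalize (mixture P).rnDeriv ν y = c at hy hc
    split_ifs with h0 hi
    · rw [Finset.prod_congr rfl fun W hW => by rw [hy W hW]]
      simp only [ENNReal.mul_rpow_of_nonneg _ _ (NNReal.coe_nonneg _)]
      rw [Finset.prod_mul_distrib, mul_comm]
      congr 1
      have : ∀ s : Finset (ProbabilityMeasure Ω),
          ∏ W ∈ s, c ^ (P W : ℝ) = c ^ ((∑ W ∈ s, P W : ℝ≥0) : ℝ) := by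
        classical
        intro s
        induction s using Finset.induction_on with
        | empty => simp
        | insert a s ha ih =>
          rw [Finset.prod_insert ha, Finset.sum_insert ha, ih, NNReal.coe_add,
            ENNReal.rpow_add_of_nonneg _ _ (NNReal.coe_nonneg _) (NNReal.coe_nonneg _)]
      rw [this, hP]; simp
    · rw [Finset.sup_congr rfl fun W hW => by rw [hy W hW, mul_comm]]
      simp only [Finset.sup_eq_iSup, ENNReal.mul_iSup]
    · have ha : 0 < α.toReal := ENNReal.toReal_pos h0 hi
      rw [Finset.sum_congr rfl fun W hW => by
        rw [hy W hW, ENNReal.mul_rpow_of_nonneg _ _ ha.le, ← mul_assoc]]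
      rw [← Finset.sum_mul, ENNReal.mul_rpow_of_nonneg _ _ (by positivity), ← ENNReal.rpow_mul,
        mul_one_div_cancel ha.ne', ENNReal.rpow_one, mul_comm]
  rw [withDensity_congr_ae key, withDensity_mul _ (Measure.measurable_rnDeriv _ _)
    (measurable_meanDensity _ _ _), Measure.withDensity_rnDeriv_eq _ _ hm]
  rfl

/-- The order one mean measure is the mixture. -/
lemma meanMeasure_one {P : ProbabilityMeasure Ω →₀ ℝ≥0} : meanMeasure 1 P = mixture P := by
  have hfin : ∀ᵐ y ∂mixture P, meanDensity 1 P (mixture P) y =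
      ∑ W ∈ P.support, (P W : ℝ≥0∞) * (W : Measure Ω).rnDeriv (mixture P) y :=
    Eventually.of_forall fun y => by simp [meanDensity]
  rw [meanMeasure, withDensity_congr_ae hfin]
  ext s hs
  rw [withDensity_apply _ hs, lintegral_finsetSum _ fun W _ =>
    (Measure.measurable_rnDeriv _ _).const_mul _]
  conv_rhs => rw [mixture]
  simp only [Measure.coe_finsetSum, Finset.sum_apply, Measure.smul_apply]
  refine Finset.sum_congr rfl fun W hW => ?_
  rw [lintegral_const_mul _ (Measure.measurable_rnDeriv _ _),
    Measure.setLIntegral_rnDeriv (absolutelyContinuous_mixture P hW), ENNReal.smul_def, smul_eq_mul]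

end

end Renyi

/-! Fix a prior and take its mixture as reference measure: the densities `x` are then bounded and
satisfy `∑ p x = 1` almost everywhere. Let `m(a)` be the mass of the mean measure of order `a` and
`F(t) = log m(1/t)`. Hölder's inequality, for finite sums and for integrals, makes `F` convex on
`(0, ∞)` (`convexOn_log_mass`), with `F(1) = 0`. The information of order `a ≠ 1` is minus the slope
of `F` between `1` and `1/a`, hence nondecreasing in `a`. Times `(1 - a)/a` it is `-log m(a)`,
nonincreasing because power means grow with their order. Times `a - 1` it is `a F(1/a)`, a
perspective of `F`, hence convex for `a > 1`. Jensen's and Hölder's inequalities attach the orders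
`0`, `1` and `∞`.

At positive orders the information is approached from below by smaller orders
(`exists_lt_information`). This survives the supremum over priors, so the capacity is nondecreasing
and lower semicontinuous, and continuity reduces to right continuity. By `exists_capacity_lt` that
holds at a positive order whenever some larger order has finite capacity. The estimates behind it
are uniform in the prior: below one, monotonicity of `(1 - a)/a` times the information; above one,
convexity; at one, the second order bound `powerMean_one_add_le`, whose remainder is controlled by
the mass at a larger order.

Density of countably many orders and levels gives the countable subset, compactness the finite one.
If right continuity fails at a finite `φ > 0`, every larger order has infinite capacity, which is
the dichotomy. -/

namespace Renyi

/-! ### Hölder inequalities -/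

/-- A homogeneous form of Young's inequality. -/
lemma rpow_mul_rpow_le_of_pos {a b u v A B : ℝ} (ha : 0 < a) (hb : 0 < b) (hab : a + b = 1)
    (hu : 0 ≤ u) (hv : 0 ≤ v) (hA : 0 < A) (hB : 0 < B) :
    u ^ a * v ^ b ≤ A ^ a * B ^ b * (a * (u / A) + b * (v / B)) := by
  have h := Real.geom_mean_le_arith_mean2_weighted ha.le hb.le (div_nonneg hu hA.le)
    (div_nonneg hv hB.le) hab
  rw [Real.div_rpow hu hA.le, Real.div_rpow hv hB.le] at h
  have hA' := Real.rpow_pos_of_pos hA a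
  have hB' := Real.rpow_pos_of_pos hB b
  calc u ^ a * v ^ b = A ^ a * B ^ b * (u ^ a / A ^ a * (v ^ b / B ^ b)) := by field_simp
    _ ≤ _ := by gcongr

/-- Hölder's inequality for finite sums, with exponents summing to one. -/
lemma sum_rpow_mul_rpow_le {ι : Type*} (s : Finset ι) {u v : ι → ℝ} {a b : ℝ} (ha : 0 < a)
    (hb : 0 < b) (hab : a + b = 1) (hu : ∀ i ∈ s, 0 ≤ u i) (hv : ∀ i ∈ s, 0 ≤ v i) :
    ∑ i ∈ s, u i ^ a * v i ^ b ≤ (∑ i ∈ s, u i) ^ a * (∑ i ∈ s, v i) ^ b := by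
  rcases (Finset.sum_nonneg hu).eq_or_lt with h | hA
  · rw [← h, Real.zero_rpow ha.ne', zero_mul]
    refine (Finset.sum_eq_zero fun i hi => ?_).le
    rw [(Finset.sum_eq_zero_iff_of_nonneg hu).1 h.symm i hi, Real.zero_rpow ha.ne', zero_mul]
  rcases (Finset.sum_nonneg hv).eq_or_lt with h | hB
  · rw [← h, Real.zero_rpow hb.ne', mul_zero]
    refine (Finset.sum_eq_zero fun i hi => ?_).le
    rw [(Finset.sum_eq_zero_iff_of_nonneg hv).1 h.symm i hi, Real.zero_rpow hb.ne', mul_zero]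
  refine (Finset.sum_le_sum fun i hi =>
    rpow_mul_rpow_le_of_pos ha hb hab (hu i hi) (hv i hi) hA hB).trans_eq ?_
  rw [← Finset.mul_sum, Finset.sum_add_distrib, ← Finset.mul_sum, ← Finset.mul_sum,
    ← Finset.sum_div, ← Finset.sum_div, div_self hA.ne', div_self hB.ne', mul_one, mul_one, hab,
    mul_one]

/-- Hölder's inequality for integrals, with exponents summing to one. -/
lemma integral_le_rpow_mul_rpow {Ω : Type*} [MeasurableSpace Ω] {μ : Measure Ω} {f u v : Ω → ℝ}
    {a b : ℝ} (ha : 0 < a) (hb : 0 < b) (hab : a + b = 1) (hu : ∀ᵐ y ∂μ, 0 ≤ u y)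
    (hv : ∀ᵐ y ∂μ, 0 ≤ v y) (hf : Integrable f μ) (hui : Integrable u μ) (hvi : Integrable v μ)
    (hA : 0 < ∫ y, u y ∂μ) (hB : 0 < ∫ y, v y ∂μ) (h : ∀ᵐ y ∂μ, f y ≤ u y ^ a * v y ^ b) :
    ∫ y, f y ∂μ ≤ (∫ y, u y ∂μ) ^ a * (∫ y, v y ∂μ) ^ b := by
  have hi := (((hui.div_const (∫ y, u y ∂μ)).const_mul a).add
    ((hvi.div_const (∫ y, v y ∂μ)).const_mul b))
  refine (integral_mono_ae hf (hi.const_mul ((∫ y, u y ∂μ) ^ a * (∫ y, v y ∂μ) ^ b)) ?_).trans_eq ?_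
  · filter_upwards [h, hu, hv] with y hy huy hvy
    exact hy.trans (rpow_mul_rpow_le_of_pos ha hb hab huy hvy hA hB)
  · rw [integral_const_mul]
    simp only [Pi.add_apply]
    rw [integral_add ((hui.div_const _).const_mul a)
      ((hvi.div_const _).const_mul b), integral_const_mul, integral_const_mul, integral_div,
      integral_div, div_self hA.ne', div_self hB.ne', mul_one, mul_one, hab, mul_one]

/-! ### Weighted power means of finitely many numbers -/

/-- The weighted power mean of order `a`. -/
noncomputable def powerMean {ι : Type*} (s : Finset ι) (p x : ι → ℝ) (a : ℝ) : ℝ :=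
  (∑ i ∈ s, p i * x i ^ a) ^ (1 / a)

section PowerMean

variable {ι : Type*} {s : Finset ι} {p x : ι → ℝ}

lemma sum_mul_rpow_nonneg (hp : ∀ i ∈ s, 0 ≤ p i) (hx : ∀ i ∈ s, 0 ≤ x i) (a : ℝ) :
    0 ≤ ∑ i ∈ s, p i * x i ^ a :=
  Finset.sum_nonneg fun i hi => mul_nonneg (hp i hi) (Real.rpow_nonneg (hx i hi) _)

lemma powerMean_nonneg (hp : ∀ i ∈ s, 0 ≤ p i) (hx : ∀ i ∈ s, 0 ≤ x i) (a : ℝ) :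
    0 ≤ powerMean s p x a :=
  Real.rpow_nonneg (sum_mul_rpow_nonneg hp hx a) _

lemma powerMean_mono (hp : ∀ i ∈ s, 0 ≤ p i) (hx : ∀ i ∈ s, 0 ≤ x i) (h1 : ∑ i ∈ s, p i = 1)
    {a b : ℝ} (ha : 0 < a) (hab : a ≤ b) : powerMean s p x a ≤ powerMean s p x b := by
  have hb := ha.trans_le hab
  have h := Real.rpow_arith_mean_le_arith_mean_rpow s p (fun i => x i ^ a) hp h1
    (fun i hi => Real.rpow_nonneg (hx i hi) _) ((one_le_div ha).2 hab)
  have h2 := Real.rpow_le_rpow (Real.rpow_nonneg (sum_mul_rpow_nonneg hp hx a) _) h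
    (one_div_pos.2 hb).le
  rw [← Real.rpow_mul (sum_mul_rpow_nonneg hp hx a),
    show b / a * (1 / b) = 1 / a by field_simp] at h2
  refine h2.trans_eq ?_
  unfold powerMean
  congr 1
  refine Finset.sum_congr rfl fun i hi => ?_
  rw [← Real.rpow_mul (hx i hi), mul_div_cancel₀ _ ha.ne']

/-- The power mean is log-convex in the inverse of its order. -/
lemma powerMean_inv_le (hp : ∀ i ∈ s, 0 ≤ p i) (hx : ∀ i ∈ s, 0 ≤ x i)
    {a b t₀ t₁ : ℝ} (ha : 0 < a) (hb : 0 < b) (hab : a + b = 1) (ht₀ : 0 < t₀) (ht₁ : 0 < t₁) :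
    powerMean s p x (a * t₀ + b * t₁)⁻¹ ≤
      powerMean s p x t₀⁻¹ ^ a * powerMean s p x t₁⁻¹ ^ b := by
  set t := a * t₀ + b * t₁ with ht
  have ht' : 0 < t := by positivity
  have hs : a * t₀ / t + b * t₁ / t = 1 := by rw [← add_div, ← ht, div_self ht'.ne']
  -- With `t = a t₀ + b t₁`, these Hölder exponents make the powers of `x` combine to `t⁻¹`; raising
  -- to the power `t` then turns them into `a t₀` and `b t₁`.
  have key := sum_rpow_mul_rpow_le s (u := fun i => p i * x i ^ t₀⁻¹)
    (v := fun i => p i * x i ^ t₁⁻¹) (a := a * t₀ / t) (b := b * t₁ / t) (by positivity)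
    (by positivity) hs
    (fun i hi => mul_nonneg (hp i hi) (Real.rpow_nonneg (hx i hi) _))
    (fun i hi => mul_nonneg (hp i hi) (Real.rpow_nonneg (hx i hi) _))
  have hS₀ := sum_mul_rpow_nonneg hp hx t₀⁻¹
  have hS₁ := sum_mul_rpow_nonneg hp hx t₁⁻¹
  have e : ∀ i ∈ s, (p i * x i ^ t₀⁻¹) ^ (a * t₀ / t) * (p i * x i ^ t₁⁻¹) ^ (b * t₁ / t) =
      p i * x i ^ t⁻¹ := by
    intro i hi
    have q0 := Real.rpow_nonneg (hx i hi) t₀⁻¹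
    have q1 := Real.rpow_nonneg (hx i hi) t₁⁻¹
    rw [Real.mul_rpow (hp i hi) q0, Real.mul_rpow (hp i hi) q1, mul_mul_mul_comm,
      ← Real.rpow_add_of_nonneg (hp i hi) (by positivity) (by positivity), hs, Real.rpow_one,
      ← Real.rpow_mul (hx i hi), ← Real.rpow_mul (hx i hi),
      ← Real.rpow_add_of_nonneg (hx i hi) (by positivity) (by positivity)]
    congr 2
    field_simp
    exact hab
  rw [Finset.sum_congr rfl e] at key
  have h2 := Real.rpow_le_rpow (sum_mul_rpow_nonneg hp hx t⁻¹) key ht'.le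
  rw [Real.mul_rpow (Real.rpow_nonneg hS₀ _) (Real.rpow_nonneg hS₁ _), ← Real.rpow_mul hS₀,
    ← Real.rpow_mul hS₁, div_mul_cancel₀ _ ht'.ne', div_mul_cancel₀ _ ht'.ne'] at h2
  unfold powerMean
  rw [← Real.rpow_mul hS₀, ← Real.rpow_mul hS₁, one_div, one_div, one_div, inv_inv, inv_inv,
    inv_inv, mul_comm t₀, mul_comm t₁]
  exact h2

/-- At `z = 0` both sides vanish; this is where `-1 < d` is needed. -/
lemma rpow_one_add_eq_mul_exp {z d : ℝ} (hz : 0 ≤ z) (hd : -1 < d) :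
    z ^ (1 + d) = z * Real.exp (d * Real.log z) := by
  rcases hz.eq_or_lt with rfl | hz
  · rw [Real.zero_rpow (by linarith), zero_mul]
  · rw [Real.rpow_add hz, Real.rpow_one, Real.rpow_def_of_pos hz, mul_comm d]

lemma sum_mul_rpow_le_one (hp : ∀ i ∈ s, 0 ≤ p i) (hx : ∀ i ∈ s, 0 ≤ x i)
    (h1 : ∑ i ∈ s, p i = 1) (hpx : ∑ i ∈ s, p i * x i = 1) {a : ℝ} (ha : 0 ≤ a) (ha1 : a ≤ 1) :
    ∑ i ∈ s, p i * x i ^ a ≤ 1 := by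
  have h : ∑ i ∈ s, p i * x i ^ a ≤ ∑ i ∈ s, p i * (1 + a * (x i - 1)) :=
    Finset.sum_le_sum fun i hi => by
      have := rpow_one_add_le_one_add_mul_self (s := x i - 1) (by linarith [hx i hi]) ha ha1
      rw [add_sub_cancel] at this
      exact mul_le_mul_of_nonneg_left this (hp i hi)
  refine h.trans_eq ?_
  have : ∀ i ∈ s, p i * (1 + a * (x i - 1)) = p i + a * (p i * x i - p i) := fun i _ => by ring
  rw [Finset.sum_congr rfl this, Finset.sum_add_distrib, ← Finset.mul_sum, Finset.sum_sub_distrib,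
    h1, hpx]
  ring

lemma one_le_sum_mul_rpow (hp : ∀ i ∈ s, 0 ≤ p i) (hx : ∀ i ∈ s, 0 ≤ x i)
    (h1 : ∑ i ∈ s, p i = 1) (hpx : ∑ i ∈ s, p i * x i = 1) {a : ℝ} (ha : 1 ≤ a) :
    1 ≤ ∑ i ∈ s, p i * x i ^ a := by
  have h : ∑ i ∈ s, p i * (1 + a * (x i - 1)) ≤ ∑ i ∈ s, p i * x i ^ a :=
    Finset.sum_le_sum fun i hi => by
      have := one_add_mul_self_le_rpow_one_add (s := x i - 1) (by linarith [hx i hi]) ha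
      rw [add_sub_cancel] at this
      exact mul_le_mul_of_nonneg_left this (hp i hi)
  refine le_trans (le_of_eq ?_) h
  have : ∀ i ∈ s, p i * (1 + a * (x i - 1)) = p i + a * (p i * x i - p i) := fun i _ => by ring
  rw [Finset.sum_congr rfl this, Finset.sum_add_distrib, ← Finset.mul_sum, Finset.sum_sub_distrib,
    h1, hpx]
  ring

/-- Drops the outer exponent `1 / a`. For `a ≤ 1` the sum is at most one and the exponent at least
one; for `a ≥ 1` both comparisons reverse. -/
lemma powerMean_le_sum (hp : ∀ i ∈ s, 0 ≤ p i) (hx : ∀ i ∈ s, 0 ≤ x i)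
    (h1 : ∑ i ∈ s, p i = 1) (hpx : ∑ i ∈ s, p i * x i = 1) {a : ℝ} (ha : 0 < a) :
    powerMean s p x a ≤ ∑ i ∈ s, p i * x i ^ a := by
  unfold powerMean
  rcases le_total a 1 with h | h
  · conv_rhs => rw [← Real.rpow_one (∑ i ∈ s, p i * x i ^ a)]
    rcases (sum_mul_rpow_nonneg hp hx a).eq_or_lt with h0 | h0
    · rw [← h0, Real.zero_rpow (by positivity), Real.zero_rpow one_ne_zero]
    exact Real.rpow_le_rpow_of_exponent_ge h0 (sum_mul_rpow_le_one hp hx h1 hpx ha.le h)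
      ((one_le_div ha).2 h)
  · conv_rhs => rw [← Real.rpow_one (∑ i ∈ s, p i * x i ^ a)]
    exact Real.rpow_le_rpow_of_exponent_le (one_le_sum_mul_rpow hp hx h1 hpx h)
      ((div_le_one ha).2 h)

/-- Jensen's inequality for `exp` under the posterior weights `p i * x i`, applied to `(a - 1) log
x`. -/
lemma exp_le_powerMean (hp : ∀ i ∈ s, 0 ≤ p i) (hx : ∀ i ∈ s, 0 ≤ x i)
    (hpx : ∑ i ∈ s, p i * x i = 1) {a : ℝ} (ha : 0 < a) :
    Real.exp ((a - 1) / a * ∑ i ∈ s, p i * x i * Real.log (x i)) ≤ powerMean s p x a := by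
  have h := convexOn_exp.map_sum_le (t := s) (w := fun i => p i * x i)
    (p := fun i => (a - 1) * Real.log (x i)) (fun i hi => mul_nonneg (hp i hi) (hx i hi)) hpx
    (fun _ _ => mem_univ _)
  simp only [smul_eq_mul] at h
  have e : ∑ i ∈ s, p i * x i * Real.exp ((a - 1) * Real.log (x i)) = ∑ i ∈ s, p i * x i ^ a :=
    Finset.sum_congr rfl fun i hi => by
      rw [mul_assoc, ← rpow_one_add_eq_mul_exp (hx i hi) (by linarith), add_sub_cancel]
  rw [e] at h
  have h2 := Real.rpow_le_rpow (Real.exp_pos _).le h (one_div_pos.2 ha).le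
  rw [← Real.exp_mul] at h2
  refine le_trans (le_of_eq ?_) h2
  congr 1
  rw [Finset.mul_sum, Finset.sum_mul]
  refine Finset.sum_congr rfl fun i _ => ?_
  field_simp

lemma exp_le_one_add_add_sq_mul_exp_abs (v : ℝ) :
    Real.exp v ≤ 1 + v + v ^ 2 * Real.exp |v| := by
  have h := Complex.norm_exp_sub_sum_le_norm_mul_exp (v : ℂ) 2
  simp only [Finset.sum_range_succ, Finset.sum_range_zero, pow_zero, Nat.factorial, Nat.cast_one,
    div_one, pow_one, zero_add, Nat.succ_eq_add_one, mul_one] at h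
  rw [Complex.norm_real, Real.norm_eq_abs, sq_abs] at h
  have e : Complex.exp v - (1 + (v : ℂ)) = ((Real.exp v - (1 + v) : ℝ) : ℂ) := by push_cast; rfl
  rw [e, Complex.norm_real, Real.norm_eq_abs] at h
  linarith [le_abs_self (Real.exp v - (1 + v))]

/-- Taylor expansion of `z exp(d u)` with `u = log z`. The factors `u ^ 2` and `exp |d u|` of the
remainder each cost a factor `exp (k|u|/2)`, and `exp (k|u|)` turns back into the powers `1 ± k` of
`z`. -/
lemma rpow_one_add_le {z d k : ℝ} (hz : 0 ≤ z) (hk : 0 < k) (hk1 : k < 1) (hd : |d| ≤ k / 2) :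
    z ^ (1 + d) ≤ z + d * (z * Real.log z) +
      d ^ 2 * (8 / k ^ 2) * (z ^ (1 + k) + z ^ (1 - k)) := by
  have hd' := abs_le.1 hd
  rw [rpow_one_add_eq_mul_exp hz (by linarith), rpow_one_add_eq_mul_exp hz (by linarith),
    sub_eq_add_neg, rpow_one_add_eq_mul_exp hz (by linarith)]
  set u := Real.log z
  have h1 := exp_le_one_add_add_sq_mul_exp_abs (d * u)
  have h2 : u ^ 2 ≤ 8 / k ^ 2 * Real.exp (k / 2 * |u|) := by
    have h3 := Real.quadratic_le_exp_of_nonneg (x := k / 2 * |u|) (by positivity)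
    have h4 : k ^ 2 / 8 * u ^ 2 ≤ Real.exp (k / 2 * |u|) := by
      have : (k / 2 * |u|) ^ 2 / 2 = k ^ 2 / 8 * u ^ 2 := by
        rw [mul_pow, sq_abs]; ring
      have : 0 ≤ k / 2 * |u| := by positivity
      linarith
    calc u ^ 2 = 8 / k ^ 2 * (k ^ 2 / 8 * u ^ 2) := by field_simp
      _ ≤ _ := by gcongr
  have h5 : Real.exp |d * u| ≤ Real.exp (k / 2 * |u|) := by
    rw [abs_mul]; gcongr
  have h6 : Real.exp (k / 2 * |u|) * Real.exp (k / 2 * |u|) ≤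
      Real.exp (k * u) + Real.exp (-k * u) := by
    rw [← Real.exp_add, ← add_mul, add_halves]
    rcases abs_cases u with ⟨h, _⟩ | ⟨h, _⟩ <;> rw [h]
    · linarith [Real.exp_pos (-k * u)]
    · rw [mul_neg, ← neg_mul]; linarith [Real.exp_pos (k * u)]
  have h7 : u ^ 2 * Real.exp |d * u| ≤ 8 / k ^ 2 * (Real.exp (k * u) + Real.exp (-k * u)) := by
    calc u ^ 2 * Real.exp |d * u|
        ≤ (8 / k ^ 2 * Real.exp (k / 2 * |u|)) * Real.exp (k / 2 * |u|) := by gcongr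
      _ = 8 / k ^ 2 * (Real.exp (k / 2 * |u|) * Real.exp (k / 2 * |u|)) := by ring
      _ ≤ _ := by gcongr
  have h8 : Real.exp (d * u) ≤
      1 + d * u + d ^ 2 * (8 / k ^ 2 * (Real.exp (k * u) + Real.exp (-k * u))) := by
    refine h1.trans ?_
    rw [mul_pow, mul_assoc]
    gcongr
  calc z * Real.exp (d * u) ≤ z * _ := mul_le_mul_of_nonneg_left h8 hz
    _ = _ := by ring

/-- The power mean inequality under the posterior weights `p i * x i`. It dictates `k = (r - 1) / r`
below: the remainder's power `1 + k` is then controlled by the mean of order `r`. -/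
lemma sum_mul_rpow_one_add_le_powerMean (hp : ∀ i ∈ s, 0 ≤ p i) (hx : ∀ i ∈ s, 0 ≤ x i)
    (hpx : ∑ i ∈ s, p i * x i = 1) {r : ℝ} (hr : 1 < r) :
    ∑ i ∈ s, p i * x i ^ (1 + (r - 1) / r) ≤ powerMean s p x r := by
  have hr0 : 0 < r := by linarith
  have hk : 0 < (r - 1) / r := div_pos (by linarith) hr0
  have h := Real.arith_mean_le_rpow_mean s (fun i => p i * x i) (fun i => x i ^ ((r - 1) / r))
    (fun i hi => mul_nonneg (hp i hi) (hx i hi)) hpx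
    (fun i hi => Real.rpow_nonneg (hx i hi) _) hr.le
  have e : ∀ c : ℝ, 0 < c → ∀ i ∈ s, p i * x i * x i ^ c = p i * x i ^ (1 + c) := fun c hc i hi => by
    rw [mul_assoc, Real.rpow_add_of_nonneg (hx i hi) zero_le_one hc.le, Real.rpow_one]
  rw [Finset.sum_congr rfl (e _ hk)] at h
  refine h.trans_eq ?_
  unfold powerMean
  congr 1
  refine Finset.sum_congr rfl fun i hi => ?_
  rw [← Real.rpow_mul (hx i hi), div_mul_cancel₀ _ hr0.ne', e _ (by linarith) i hi, add_sub_cancel]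

/-- A second order upper bound on the power mean around the order one, uniform in the weights. -/
lemma powerMean_one_add_le (hp : ∀ i ∈ s, 0 ≤ p i) (hx : ∀ i ∈ s, 0 ≤ x i)
    (h1 : ∑ i ∈ s, p i = 1) (hpx : ∑ i ∈ s, p i * x i = 1) {r k d : ℝ} (hr : 1 < r)
    (hk : k = (r - 1) / r) (hd : |d| ≤ k / 2) :
    powerMean s p x (1 + d) ≤ 1 + d * (∑ i ∈ s, p i * x i * Real.log (x i)) +
      d ^ 2 * (8 / k ^ 2) * (powerMean s p x r + 1) := by
  have hr0 : 0 < r := by linarith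
  have hk0 : 0 < k := hk ▸ div_pos (by linarith) hr0
  have hk1 : k < 1 := by rw [hk, div_lt_one hr0]; linarith
  have hd' := abs_le.1 hd
  refine (powerMean_le_sum hp hx h1 hpx (by linarith)).trans ?_
  have h2 : ∑ i ∈ s, p i * x i ^ (1 + d) ≤ ∑ i ∈ s, p i * (x i + d * (x i * Real.log (x i)) +
      d ^ 2 * (8 / k ^ 2) * (x i ^ (1 + k) + x i ^ (1 - k))) :=
    Finset.sum_le_sum fun i hi =>
      mul_le_mul_of_nonneg_left (rpow_one_add_le (hx i hi) hk0 hk1 hd) (hp i hi)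
  have h3 : ∑ i ∈ s, p i * (x i + d * (x i * Real.log (x i)) +
      d ^ 2 * (8 / k ^ 2) * (x i ^ (1 + k) + x i ^ (1 - k))) =
      1 + d * (∑ i ∈ s, p i * x i * Real.log (x i)) + d ^ 2 * (8 / k ^ 2) *
        (∑ i ∈ s, p i * x i ^ (1 + k) + ∑ i ∈ s, p i * x i ^ (1 - k)) := by
    rw [← hpx, Finset.mul_sum, ← Finset.sum_add_distrib, ← Finset.sum_add_distrib, Finset.mul_sum,
      ← Finset.sum_add_distrib]
    exact Finset.sum_congr rfl fun i _ => by ring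
  rw [h3] at h2
  refine h2.trans ?_
  gcongr
  · rw [hk]; exact sum_mul_rpow_one_add_le_powerMean hp hx hpx hr
  · exact sum_mul_rpow_le_one hp hx h1 hpx (by linarith) (by linarith)

/-- Uses `x ^ a ≤ x * M ^ (a - 1)` and `∑ p x = 1`. -/
lemma powerMean_le_rpow_of_le (hp : ∀ i ∈ s, 0 ≤ p i) (hx : ∀ i ∈ s, 0 ≤ x i)
    (hpx : ∑ i ∈ s, p i * x i = 1) {a M : ℝ} (ha : 1 < a) (hM : ∀ i ∈ s, x i ≤ M)
    (hM0 : 0 ≤ M) : powerMean s p x a ≤ M ^ ((a - 1) / a) := by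
  have ha0 : 0 < a := by linarith
  have h : ∑ i ∈ s, p i * x i ^ a ≤ M ^ (a - 1) := by
    have h2 : ∑ i ∈ s, p i * x i ^ a ≤ ∑ i ∈ s, p i * x i * M ^ (a - 1) :=
      Finset.sum_le_sum fun i hi => by
        have e : x i ^ a = x i * x i ^ (a - 1) := by
          conv_rhs => rw [← Real.rpow_one (x i), ← Real.rpow_mul (hx i hi), one_mul]
          rw [← Real.rpow_add_of_nonneg (hx i hi) zero_le_one (by linarith), add_sub_cancel]
        rw [e, mul_assoc]
        have := Real.rpow_le_rpow (hx i hi) (hM i hi) (z := a - 1) (by linarith)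
        exact mul_le_mul_of_nonneg_left (mul_le_mul_of_nonneg_left this (hx i hi)) (hp i hi)
    rwa [← Finset.sum_mul, hpx, one_mul] at h2
  have h3 := Real.rpow_le_rpow (sum_mul_rpow_nonneg hp hx a) h (one_div_pos.2 ha0).le
  rwa [← Real.rpow_mul hM0, mul_one_div] at h3

lemma rpow_mul_le_powerMean (hp : ∀ i ∈ s, 0 ≤ p i) (hx : ∀ i ∈ s, 0 ≤ x i) {a c : ℝ}
    (ha : 0 < a) (hc0 : 0 ≤ c) (hc : ∀ i ∈ s, c ≤ p i) {i : ι} (hi : i ∈ s) :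
    c ^ (1 / a) * x i ≤ powerMean s p x a := by
  have h : c * x i ^ a ≤ ∑ i ∈ s, p i * x i ^ a :=
    (mul_le_mul_of_nonneg_right (hc i hi) (Real.rpow_nonneg (hx i hi) _)).trans
      (Finset.single_le_sum (f := fun i => p i * x i ^ a)
        (fun j hj => mul_nonneg (hp j hj) (Real.rpow_nonneg (hx j hj) _)) hi)
  have h2 := Real.rpow_le_rpow (mul_nonneg hc0 (Real.rpow_nonneg (hx i hi) _)) h
    (one_div_pos.2 ha).le
  rwa [Real.mul_rpow hc0 (Real.rpow_nonneg (hx i hi) _), ← Real.rpow_mul (hx i hi),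
    mul_one_div_cancel ha.ne', Real.rpow_one] at h2

-- Hölder's inequality with exponents `1 - a` and `a`, splitting `p x ^ a` into the prior weight on
-- `{x > 0}` and the posterior weight `p x`, which sums to one. This links order zero to the
-- positive orders.
open Classical in
lemma powerMean_le_rpow_sum_pos (hp : ∀ i ∈ s, 0 ≤ p i) (hx : ∀ i ∈ s, 0 ≤ x i)
    (hpx : ∑ i ∈ s, p i * x i = 1) {a : ℝ} (ha : 0 < a) (ha1 : a < 1) :
    powerMean s p x a ≤ (∑ i ∈ s, if 0 < x i then p i else 0) ^ ((1 - a) / a) := by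
  have hif : ∀ i ∈ s, 0 ≤ if 0 < x i then p i else 0 := fun i hi => by
    split_ifs
    exacts [hp i hi, le_rfl]
  have h := sum_rpow_mul_rpow_le s (u := fun i => if 0 < x i then p i else 0)
    (v := fun i => p i * x i) (a := 1 - a) (b := a) (by linarith) ha (by ring) hif
    (fun i hi => mul_nonneg (hp i hi) (hx i hi))
  rw [hpx, Real.one_rpow, mul_one] at h
  have e : ∀ i ∈ s, (if 0 < x i then p i else 0) ^ (1 - a) * (p i * x i) ^ a = p i * x i ^ a := by
    intro i hi
    rcases (hx i hi).eq_or_lt with h0 | h0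
    · rw [← h0, mul_zero, Real.zero_rpow ha.ne', mul_zero, mul_zero]
    · rw [if_pos h0, Real.mul_rpow (hp i hi) h0.le, ← mul_assoc,
        ← Real.rpow_add_of_nonneg (hp i hi) (by linarith) ha.le, sub_add_cancel, Real.rpow_one]
  rw [Finset.sum_congr rfl e] at h
  have h3 := Real.rpow_le_rpow (sum_mul_rpow_nonneg hp hx a) h (one_div_pos.2 ha).le
  rwa [← Real.rpow_mul (Finset.sum_nonneg hif), mul_one_div] at h3

end PowerMean

lemma powerMean_le_of_le {ι : Type*} {s : Finset ι} {p x : ι → ℝ} (hp : ∀ i ∈ s, 0 ≤ p i)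
    (hx : ∀ i ∈ s, 0 ≤ x i) (h1 : ∑ i ∈ s, p i = 1) {a M : ℝ} (ha : 0 < a)
    (hM : ∀ i ∈ s, x i ≤ M) (hM0 : 0 ≤ M) : powerMean s p x a ≤ M := by
  have h : ∑ i ∈ s, p i * x i ^ a ≤ M ^ a := by
    have h2 : ∑ i ∈ s, p i * x i ^ a ≤ ∑ i ∈ s, p i * M ^ a :=
      Finset.sum_le_sum fun i hi =>
        mul_le_mul_of_nonneg_left (Real.rpow_le_rpow (hx i hi) (hM i hi) ha.le) (hp i hi)
    rwa [← Finset.sum_mul, h1, one_mul] at h2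
  have h3 := Real.rpow_le_rpow (sum_mul_rpow_nonneg hp hx a) h (one_div_pos.2 ha).le
  rwa [← Real.rpow_mul hM0, mul_one_div_cancel ha.ne', Real.rpow_one] at h3

/-! ### Densities and total masses for a fixed prior -/

noncomputable section

variable {Ω : Type*} [MeasurableSpace Ω]

/-- The real valued density of `W` with respect to the mixture. -/
def dens (P : ProbabilityMeasure Ω →₀ ℝ≥0) (y : Ω) (W : ProbabilityMeasure Ω) : ℝ :=
  ((W : Measure Ω).rnDeriv (mixture P) y).toReal

/-- The power mean of the densities. -/
def meanDens (P : ProbabilityMeasure Ω →₀ ℝ≥0) (a : ℝ) (y : Ω) : ℝ :=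
  powerMean P.support (fun W => (P W : ℝ)) (dens P y) a

/-- The maximum of the densities. -/
def supDens (P : ProbabilityMeasure Ω →₀ ℝ≥0) (y : Ω) : ℝ :=
  (P.support.sup fun W => (W : Measure Ω).rnDeriv (mixture P) y).toReal

/-- The integrand of the order one information. -/
def entDens (P : ProbabilityMeasure Ω →₀ ℝ≥0) (y : Ω) : ℝ :=
  ∑ W ∈ P.support, (P W : ℝ) * dens P y W * Real.log (dens P y W)

/-- The total mass of the mean measure of finite positive order. -/
def mass (P : ProbabilityMeasure Ω →₀ ℝ≥0) (a : ℝ) : ℝ := ∫ y, meanDens P a y ∂mixture P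

/-- The total mass of the mean measure of infinite order. -/
def massTop (P : ProbabilityMeasure Ω →₀ ℝ≥0) : ℝ := ∫ y, supDens P y ∂mixture P

/-- The order one information as a real number. -/
def mutualInfo (P : ProbabilityMeasure Ω →₀ ℝ≥0) : ℝ := ∫ y, entDens P y ∂mixture P

variable {P : ProbabilityMeasure Ω →₀ ℝ≥0}

lemma weight_nonneg : ∀ W ∈ P.support, 0 ≤ (P W : ℝ) := fun W _ => (P W).coe_nonneg

lemma dens_nonneg {y : Ω} : ∀ W ∈ P.support, 0 ≤ dens P y W := fun _ _ => ENNReal.toReal_nonneg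

lemma measurable_dens (W : ProbabilityMeasure Ω) : Measurable fun y => dens P y W :=
  (Measure.measurable_rnDeriv _ _).ennreal_toReal

lemma measurable_meanDens (a : ℝ) : Measurable (meanDens P a) :=
  (Finset.measurable_fun_sum _ fun _ _ => ((measurable_dens _).pow_const _).const_mul _).pow_const _

lemma measurable_supDens : Measurable (supDens P) := by
  unfold supDens
  simp only [Finset.sup_eq_iSup]
  exact (Measurable.biSup _ P.support.countable_toSet
      fun W _ => Measure.measurable_rnDeriv _ _).ennreal_toReal

lemma measurable_entDens : Measurable (entDens P) :=
  Finset.measurable_fun_sum _ fun _ _ =>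
    ((measurable_dens _).const_mul _).mul (Real.measurable_log.comp (measurable_dens _))

lemma meanDens_nonneg (a : ℝ) (y : Ω) : 0 ≤ meanDens P a y :=
  powerMean_nonneg weight_nonneg dens_nonneg a

lemma ae_rnDeriv_ne_top :
    ∀ᵐ y ∂mixture P, ∀ W ∈ P.support, (W : Measure Ω).rnDeriv (mixture P) y ≠ ∞ :=
  (Finset.eventually_all P.support).2 fun _ _ => Measure.rnDeriv_ne_top _ _

/-- The order one mean measure is the mixture itself, so its density equals one by uniqueness of
densities. -/
lemma ae_sum_dens : ∀ᵐ y ∂mixture P, ∑ W ∈ P.support, (P W : ℝ) * dens P y W = 1 := by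
  have h : (mixture P).withDensity (meanDensity 1 P (mixture P)) = (mixture P).withDensity 1 := by
    rw [withDensity_one]
    exact meanMeasure_one
  have h2 := (withDensity_eq_iff_of_sigmaFinite (measurable_meanDensity _ _ _).aemeasurable
    measurable_one.aemeasurable).1 h
  filter_upwards [h2, ae_rnDeriv_ne_top (P := P)] with y hy hf
  have h3 := congrArg ENNReal.toReal hy
  simp only [meanDensity, one_ne_zero, ENNReal.one_ne_top, if_false, ENNReal.toReal_one,
    ENNReal.rpow_one, div_one, Pi.one_apply] at h3
  rw [ENNReal.toReal_sum fun W hW => ENNReal.mul_ne_top ENNReal.coe_ne_top (hf W hW)] at h3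
  simpa [dens] using h3

section Prior

variable (hP : ∑ W ∈ P.support, P W = 1)

include hP

lemma sum_weight : ∑ W ∈ P.support, (P W : ℝ) = 1 := by
  exact_mod_cast hP

lemma isProbabilityMeasure_mixture : IsProbabilityMeasure (mixture P) := by
  refine ⟨?_⟩
  simp only [mixture, Measure.coe_finsetSum, Finset.sum_apply, Measure.smul_apply, measure_univ,
    ENNReal.smul_def, smul_eq_mul, mul_one]
  exact_mod_cast hP

lemma support_nonempty : P.support.Nonempty := by
  rw [Finset.nonempty_iff_ne_empty]
  intro h
  rw [h] at hP
  simp at hP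

lemma exists_pos_le_weight : ∃ c : ℝ, 0 < c ∧ ∀ W ∈ P.support, c ≤ (P W : ℝ) := by
  obtain ⟨W, hW, h⟩ := P.support.exists_min_image (fun W => (P W : ℝ)) (support_nonempty hP)
  exact ⟨P W, NNReal.coe_pos.2 (pos_iff_ne_zero.2 (Finsupp.mem_support_iff.1 hW)), h⟩

/-- Since `∑ p x = 1`, each density is at most the inverse of the least weight. This boundedness
gives all the integrability that follows. -/
lemma exists_dens_le : ∃ M : ℝ, 0 ≤ M ∧ ∀ᵐ y ∂mixture P, ∀ W ∈ P.support, dens P y W ≤ M := by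
  obtain ⟨c, hc, h⟩ := exists_pos_le_weight hP
  refine ⟨c⁻¹, (inv_pos.2 hc).le, ?_⟩
  filter_upwards [ae_sum_dens (P := P)] with y hy W hW
  have h2 := Finset.single_le_sum (f := fun W => (P W : ℝ) * dens P y W)
    (fun V hV => mul_nonneg (weight_nonneg V hV) (dens_nonneg V hV)) hW
  have h3 := mul_le_mul_of_nonneg_right (h W hW) (dens_nonneg (y := y) W hW)
  rw [← mul_one c⁻¹, le_inv_mul_iff₀ hc]
  linarith

lemma ae_supDens : ∀ᵐ y ∂mixture P, (∀ W ∈ P.support, dens P y W ≤ supDens P y) ∧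
    ∃ W ∈ P.support, supDens P y = dens P y W := by
  filter_upwards [ae_rnDeriv_ne_top (P := P)] with y hy
  obtain ⟨W, hW, h⟩ := Finset.exists_mem_eq_sup P.support (support_nonempty hP)
    fun W => (W : Measure Ω).rnDeriv (mixture P) y
  have e : supDens P y = dens P y W := by rw [supDens, h, dens]
  refine ⟨fun V hV => ?_, W, hW, e⟩
  rw [e]
  refine ENNReal.toReal_mono (hy W hW) ?_
  rw [← h]
  exact Finset.le_sup (f := fun W : ProbabilityMeasure Ω => (W : Measure Ω).rnDeriv (mixture P) y) hV

lemma integrable_meanDens {a : ℝ} (ha : 0 < a) : Integrable (meanDens P a) (mixture P) := by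
  obtain ⟨M, hM0, hM⟩ := exists_dens_le hP
  refine Integrable.of_bound (measurable_meanDens a).aestronglyMeasurable M ?_
  filter_upwards [hM] with y hy
  rw [Real.norm_of_nonneg (meanDens_nonneg a y)]
  exact powerMean_le_of_le weight_nonneg dens_nonneg (sum_weight hP) ha hy hM0

lemma integrable_supDens : Integrable (supDens P) (mixture P) := by
  obtain ⟨M, hM0, hM⟩ := exists_dens_le hP
  refine Integrable.of_bound measurable_supDens.aestronglyMeasurable M ?_
  filter_upwards [hM, ae_supDens hP] with y hy ⟨_, W, hW, h⟩
  rw [h, Real.norm_of_nonneg (dens_nonneg W hW)]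
  exact hy W hW

lemma integrable_entDens : Integrable (entDens P) (mixture P) := by
  obtain ⟨M, hM0, hM⟩ := exists_dens_le hP
  obtain ⟨C, hC⟩ := isCompact_Icc.exists_bound_of_continuousOn (s := Icc (0 : ℝ) M)
    Real.continuous_mul_log.continuousOn
  refine Integrable.of_bound measurable_entDens.aestronglyMeasurable C ?_
  filter_upwards [hM] with y hy
  calc ‖entDens P y‖ ≤ ∑ W ∈ P.support, ‖(P W : ℝ) * dens P y W * Real.log (dens P y W)‖ :=
        norm_sum_le _ _
    _ ≤ ∑ W ∈ P.support, (P W : ℝ) * C := Finset.sum_le_sum fun W hW => by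
        rw [mul_assoc, norm_mul, Real.norm_of_nonneg (weight_nonneg W hW)]
        exact mul_le_mul_of_nonneg_left (hC _ ⟨dens_nonneg W hW, hy W hW⟩) (weight_nonneg W hW)
    _ = C := by rw [← Finset.sum_mul, sum_weight hP, one_mul]

lemma mass_one : mass P 1 = 1 := by
  have := isProbabilityMeasure_mixture hP
  have h : meanDens P 1 =ᵐ[mixture P] fun _ => 1 := by
    filter_upwards [ae_sum_dens (P := P)] with y hy
    simpa [meanDens, powerMean] using hy
  rw [mass, integral_congr_ae h]
  simp

lemma mass_mono {a b : ℝ} (ha : 0 < a) (hab : a ≤ b) : mass P a ≤ mass P b :=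
  integral_mono (integrable_meanDens hP ha) (integrable_meanDens hP (ha.trans_le hab)) fun _ =>
    powerMean_mono weight_nonneg dens_nonneg (sum_weight hP) ha hab

lemma exp_le_mass {a : ℝ} (ha : 0 < a) : Real.exp ((a - 1) / a * mutualInfo P) ≤ mass P a := by
  have := isProbabilityMeasure_mixture hP
  have hi := (integrable_entDens hP).const_mul ((a - 1) / a)
  set c := (a - 1) / a * mutualInfo P with hc
  -- The tangent line of `exp` at the mean `c`; its linear term integrates to zero, so this is
  -- Jensen's inequality for the integral.
  have h : ∀ᵐ y ∂mixture P,
      Real.exp c * (1 + ((a - 1) / a * entDens P y - c)) ≤ meanDens P a y := by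
    filter_upwards [ae_sum_dens (P := P)] with y hy
    refine le_trans ?_ (exp_le_powerMean weight_nonneg dens_nonneg hy ha)
    have h2 := Real.add_one_le_exp ((a - 1) / a * entDens P y - c)
    calc _ ≤ Real.exp c * Real.exp ((a - 1) / a * entDens P y - c) := by gcongr; linarith
      _ = _ := by rw [← Real.exp_add, add_sub_cancel]; rfl
  refine le_trans (le_of_eq ?_) (integral_mono_ae
    ((((integrable_const 1).add (hi.sub (integrable_const c))).const_mul (Real.exp c)))
      (integrable_meanDens hP ha) h)
  rw [integral_const_mul]
  rw [integral_add' (integrable_const _) (hi.sub (integrable_const c)),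
    integral_sub' hi (integrable_const c), integral_const_mul]
  simp only [integral_const, probReal_univ, smul_eq_mul, one_mul]
  rw [← mutualInfo, ← hc]
  ring

lemma mass_pos {a : ℝ} (ha : 0 < a) : 0 < mass P a := (Real.exp_pos _).trans_le (exp_le_mass hP ha)

lemma mass_inv_le {a b t₀ t₁ : ℝ} (ha : 0 < a) (hb : 0 < b) (hab : a + b = 1) (ht₀ : 0 < t₀)
    (ht₁ : 0 < t₁) :
    mass P (a * t₀ + b * t₁)⁻¹ ≤ mass P t₀⁻¹ ^ a * mass P t₁⁻¹ ^ b :=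
  integral_le_rpow_mul_rpow ha hb hab (Eventually.of_forall fun y => meanDens_nonneg _ y)
    (Eventually.of_forall fun y => meanDens_nonneg _ y)
    (integrable_meanDens hP (by positivity)) (integrable_meanDens hP (by positivity))
    (integrable_meanDens hP (by positivity)) (mass_pos hP (by positivity))
    (mass_pos hP (by positivity)) (Eventually.of_forall fun _ =>
      powerMean_inv_le weight_nonneg dens_nonneg ha hb hab ht₀ ht₁)

lemma mass_one_add_le {r k d : ℝ} (hr : 1 < r) (hk : k = (r - 1) / r) (hd : |d| ≤ k / 2) :
    mass P (1 + d) ≤ 1 + d * mutualInfo P + d ^ 2 * (8 / k ^ 2) * (mass P r + 1) := by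
  have := isProbabilityMeasure_mixture hP
  have hr0 : 0 < r := by linarith
  have hk1 : k < 1 := by rw [hk, div_lt_one hr0]; linarith
  have hd' := abs_le.1 hd
  have hi := ((integrable_const (μ := mixture P) (1 : ℝ)).add
    ((integrable_entDens hP).const_mul d))
  have hj := ((integrable_meanDens hP hr0).add (integrable_const (1 : ℝ))).const_mul
    (d ^ 2 * (8 / k ^ 2))
  refine (integral_mono_ae (integrable_meanDens hP (by linarith)) (hi.add hj) ?_).trans_eq ?_
  · filter_upwards [ae_sum_dens (P := P)] with y hy
    exact powerMean_one_add_le weight_nonneg dens_nonneg (sum_weight hP) hy hr hk hd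
  · rw [integral_add' hi hj, integral_add' (integrable_const _)
      ((integrable_entDens hP).const_mul d), integral_const_mul, integral_const_mul,
      integral_add' (integrable_meanDens hP hr0) (integrable_const _)]
    simp [mutualInfo, mass]

lemma one_le_massTop : 1 ≤ massTop P := by
  rw [← mass_one hP]
  refine integral_mono_ae (integrable_meanDens hP one_pos) (integrable_supDens hP) ?_
  filter_upwards [ae_supDens hP] with y ⟨h, _⟩
  exact powerMean_le_of_le weight_nonneg dens_nonneg (sum_weight hP) one_pos h
    ENNReal.toReal_nonneg

/-- Pointwise the mean is at most a power of the maximum; Hölder's inequality against the constant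
one moves that power outside the integral. -/
lemma mass_le_massTop_rpow {a : ℝ} (ha : 1 < a) : mass P a ≤ massTop P ^ ((a - 1) / a) := by
  have := isProbabilityMeasure_mixture hP
  have ha0 : 0 < a := by linarith
  have h := integral_le_rpow_mul_rpow (μ := mixture P) (f := meanDens P a) (u := supDens P)
    (v := fun _ => 1) (a := (a - 1) / a) (b := 1 / a) (div_pos (by linarith) ha0)
    (by positivity) (by field_simp; ring) (Eventually.of_forall fun _ => ENNReal.toReal_nonneg)
    (Eventually.of_forall fun _ => zero_le_one) (integrable_meanDens hP ha0)
    (integrable_supDens hP) (integrable_const _) (one_pos.trans_le (one_le_massTop hP))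
    (by simp) (by
      filter_upwards [ae_supDens hP, ae_sum_dens (P := P)] with y ⟨h, _⟩ hy
      rw [Real.one_rpow, mul_one]
      exact powerMean_le_rpow_of_le weight_nonneg dens_nonneg hy ha h ENNReal.toReal_nonneg)
  simpa [massTop, mass] using h

lemma rpow_mul_massTop_le {a c : ℝ} (ha : 0 < a) (hc0 : 0 ≤ c)
    (hc : ∀ W ∈ P.support, c ≤ (P W : ℝ)) : c ^ (1 / a) * massTop P ≤ mass P a := by
  rw [massTop, ← integral_const_mul]
  refine integral_mono_ae ((integrable_supDens hP).const_mul _) (integrable_meanDens hP ha) ?_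
  filter_upwards [ae_supDens hP] with y ⟨_, W, hW, h⟩
  simp only [h]
  exact rpow_mul_le_powerMean weight_nonneg dens_nonneg ha hc0 hc hW

end Prior
end

/-! ### The information of a fixed prior as a function of the order -/

noncomputable section

variable {Ω : Type*} [MeasurableSpace Ω] {P : ProbabilityMeasure Ω →₀ ℝ≥0}

/-- The Rényi information of finite positive order as a real number. -/
def infoReal (P : ProbabilityMeasure Ω →₀ ℝ≥0) (a : ℝ) : ℝ :=
  if a = 1 then mutualInfo P else a / (a - 1) * Real.log (mass P a)

section Prior

variable (hP : ∑ W ∈ P.support, P W = 1)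

include hP

lemma meanMeasure_ofReal_univ {a : ℝ} (ha : 0 < a) :
    meanMeasure (ENNReal.ofReal a) P univ = ENNReal.ofReal (mass P a) := by
  rw [meanMeasure, withDensity_apply _ MeasurableSet.univ, Measure.restrict_univ, mass,
    ofReal_integral_eq_lintegral_ofReal (integrable_meanDens hP ha)
      (Eventually.of_forall (meanDens_nonneg a))]
  refine lintegral_congr_ae ?_
  filter_upwards [ae_rnDeriv_ne_top (P := P)] with y hy
  rw [meanDensity, if_neg (ENNReal.ofReal_pos.2 ha).ne', if_neg ENNReal.ofReal_ne_top,
    ENNReal.toReal_ofReal ha.le, meanDens, powerMean,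
    ← ENNReal.ofReal_rpow_of_nonneg (sum_mul_rpow_nonneg weight_nonneg dens_nonneg a)
      (one_div_pos.2 ha).le,
    ENNReal.ofReal_sum_of_nonneg fun W hW =>
      mul_nonneg (weight_nonneg W hW) (Real.rpow_nonneg (dens_nonneg W hW) _)]
  congr 1
  refine Finset.sum_congr rfl fun W hW => ?_
  rw [ENNReal.ofReal_mul (weight_nonneg W hW), ENNReal.ofReal_coe_nnreal,
    ← ENNReal.ofReal_rpow_of_nonneg (dens_nonneg W hW) ha.le, dens, ENNReal.ofReal_toReal (hy W hW)]

lemma meanMeasure_top_univ : meanMeasure ∞ P univ = ENNReal.ofReal (massTop P) := by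
  rw [meanMeasure, withDensity_apply _ MeasurableSet.univ, Measure.restrict_univ, massTop,
    ofReal_integral_eq_lintegral_ofReal (integrable_supDens hP)
      (Eventually.of_forall fun _ => ENNReal.toReal_nonneg)]
  refine lintegral_congr_ae ?_
  filter_upwards [ae_rnDeriv_ne_top (P := P)] with y hy
  rw [meanDensity, if_neg ENNReal.top_ne_zero, if_pos rfl, supDens, ENNReal.ofReal_toReal]
  exact (Finset.sup_lt_iff (by simp)).2 (fun W hW => (hy W hW).lt_top) |>.ne

lemma information_top : information ∞ P = (Real.log (massTop P) : ℝ) := by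
  rw [information, if_neg ENNReal.top_ne_zero, if_neg ENNReal.top_ne_one, if_pos rfl,
    meanMeasure_top_univ hP, ENNReal.log_ofReal_of_pos (one_pos.trans_le (one_le_massTop hP))]

omit hP in
lemma posterior_eq (y : Ω) (W : ProbabilityMeasure Ω) :
    (posterior P W y).toReal = (P W : ℝ) * dens P y W := by
  rw [posterior, meanMeasure_one, ENNReal.toReal_mul, ENNReal.coe_toReal, dens]

omit hP in
lemma information_one : information 1 P = (mutualInfo P : ℝ) := by
  rw [information, if_neg one_ne_zero, if_pos rfl, meanMeasure_one, mutualInfo]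
  refine congrArg Real.toEReal (integral_congr_ae (Eventually.of_forall fun y => ?_))
  refine Finset.sum_congr rfl fun W hW => ?_
  have h : (P W : ℝ) ≠ 0 := NNReal.coe_ne_zero.2 (Finsupp.mem_support_iff.1 hW)
  simp only [posterior_eq]
  rw [mul_div_cancel_left₀ _ h]

lemma information_ofReal {a : ℝ} (ha : 0 < a) :
    information (ENNReal.ofReal a) P = (infoReal P a : ℝ) := by
  unfold infoReal
  split_ifs with h
  · rw [h, ENNReal.ofReal_one, information_one]
  · rw [information, if_neg (ENNReal.ofReal_pos.2 ha).ne', if_neg (by simpa using h),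
      if_neg ENNReal.ofReal_ne_top, ENNReal.toReal_ofReal ha.le, meanMeasure_ofReal_univ hP ha,
      ENNReal.log_ofReal_of_pos (mass_pos hP ha), EReal.coe_mul]

-- A level `r` below the order zero information bounds the prior weight of `{x > 0}` by `exp (-r)`
-- almost everywhere, hence the mass by `exp (-r) ^ ((1 - a) / a)`. The factor `a / (a - 1)` is
-- negative, so the information of order `a` is at least `r`.
open Classical in
lemma information_zero_le {a : ℝ} (ha : 0 < a) (ha1 : a < 1) :
    information 0 P ≤ (infoReal P a : ℝ) := by
  have := isProbabilityMeasure_mixture hP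
  by_contra! hlt
  obtain ⟨r, hr, hr'⟩ := EReal.lt_iff_exists_real_btwn.1 hlt
  rw [information, if_pos rfl, meanMeasure_one] at hr'
  have hk : 0 < (1 - a) / a := div_pos (by linarith) ha
  have hm : mass P a ≤ Real.exp (-r) ^ ((1 - a) / a) := by
    have h : ∀ᵐ y ∂mixture P, meanDens P a y ≤ Real.exp (-r) ^ ((1 - a) / a) := by
      filter_upwards [ae_sum_dens (P := P), ae_rnDeriv_ne_top (P := P),
        ae_essInf_le (μ := mixture P) (f := fun y => ENNReal.log
          (1 / ∑ W ∈ P.support, if 0 < posterior P W y then (P W : ℝ≥0∞) else 0))]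
        with y hy hf hy'
      have hy2 := hr'.trans_le hy'
      have e : (∑ W ∈ P.support, if 0 < posterior P W y then (P W : ℝ≥0∞) else 0) =
          ENNReal.ofReal (∑ W ∈ P.support, if 0 < dens P y W then (P W : ℝ) else 0) := by
        rw [ENNReal.ofReal_sum_of_nonneg fun W hW => by
          split_ifs
          exacts [weight_nonneg W hW, le_rfl]]
        refine Finset.sum_congr rfl fun W hW => ?_
        have hiff : 0 < posterior P W y ↔ 0 < dens P y W := by
          rw [posterior, meanMeasure_one, dens, ENNReal.toReal_pos_iff, ENNReal.mul_pos_iff]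
          simp [(hf W hW).lt_top, pos_iff_ne_zero.2 (Finsupp.mem_support_iff.1 hW)]
        simp only [hiff]
        split_ifs <;> simp
      set t := ∑ W ∈ P.support, if 0 < dens P y W then (P W : ℝ) else 0
      have ht0 : 0 ≤ t := Finset.sum_nonneg fun W hW => by
        split_ifs
        exacts [weight_nonneg W hW, le_rfl]
      refine (powerMean_le_rpow_sum_pos weight_nonneg dens_nonneg hy ha ha1).trans
        (Real.rpow_le_rpow ht0 ?_ hk.le)
      rcases ht0.eq_or_lt with h0 | h0
      · exact h0.symm.le.trans (Real.exp_pos _).le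
      · rw [e, one_div, ← ENNReal.ofReal_inv_of_pos h0,
          ENNReal.log_ofReal_of_pos (inv_pos.2 h0), EReal.coe_lt_coe_iff, Real.log_inv] at hy2
        rw [← Real.log_le_iff_le_exp h0]
        linarith
    refine (integral_mono_ae (integrable_meanDens hP ha) (integrable_const _) h).trans_eq ?_
    simp
  have h2 := Real.log_le_log (mass_pos hP ha) hm
  rw [Real.log_rpow (Real.exp_pos _), Real.log_exp] at h2
  rw [infoReal, if_neg ha1.ne, EReal.coe_lt_coe_iff] at hr
  have h3 : a / (1 - a) * Real.log (mass P a) ≤ a / (1 - a) * ((1 - a) / a * -r) :=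
    mul_le_mul_of_nonneg_left h2 (div_pos ha (by linarith)).le
  have h1a : (1 - a) ≠ 0 := by linarith
  have e1 : a / (1 - a) * ((1 - a) / a * -r) = -r := by field_simp
  have e2 : a / (a - 1) = -(a / (1 - a)) := by rw [← div_neg, neg_sub]
  rw [e2] at hr
  linarith

lemma convexOn_log_mass : ConvexOn ℝ (Ioi 0) fun t : ℝ => Real.log (mass P t⁻¹) := by
  refine convexOn_iff_forall_pos.2 ⟨convex_Ioi 0, fun t₀ ht₀ t₁ ht₁ a b ha hb hab => ?_⟩
  have ht₀' : 0 < t₀ := ht₀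
  have ht₁' : 0 < t₁ := ht₁
  have h := Real.log_le_log (mass_pos hP (by positivity)) (mass_inv_le hP ha hb hab ht₀' ht₁')
  have p0 := mass_pos hP (inv_pos.2 ht₀')
  have p1 := mass_pos hP (inv_pos.2 ht₁')
  rwa [Real.log_mul (by positivity) (by positivity), Real.log_rpow p0, Real.log_rpow p1] at h

lemma infoReal_eq_neg_slope {a : ℝ} (ha : 0 < a) (ha1 : a ≠ 1) :
    infoReal P a = -slope (fun t : ℝ => Real.log (mass P t⁻¹)) 1 a⁻¹ := by
  rw [infoReal, if_neg ha1, slope_def_field, inv_inv, inv_one, mass_one hP, Real.log_one, sub_zero]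
  have h : a - 1 ≠ 0 := sub_ne_zero.2 ha1
  have h2 : a⁻¹ - 1 = -((a - 1) / a) := by field_simp; ring
  rw [h2, div_neg, neg_neg, div_div_eq_mul_div, mul_comm, mul_div_assoc]

lemma infoReal_le_mutualInfo {a : ℝ} (ha : 0 < a) (ha1 : a < 1) :
    infoReal P a ≤ mutualInfo P := by
  have h := (Real.le_log_iff_exp_le (mass_pos hP ha)).2 (exp_le_mass hP ha)
  have hk : 0 < a / (1 - a) := div_pos ha (by linarith)
  have h2 := mul_le_mul_of_nonneg_left h hk.le
  have h1a : (1 - a) ≠ 0 := by linarith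
  have h1a' : (a - 1) ≠ 0 := by linarith
  have e1 : a / (1 - a) * ((a - 1) / a * mutualInfo P) = -mutualInfo P := by field_simp; ring
  have e2 : a / (a - 1) = -(a / (1 - a)) := by rw [← div_neg, neg_sub]
  rw [infoReal, if_neg ha1.ne, e2]
  linarith

lemma mutualInfo_le_infoReal {a : ℝ} (ha1 : 1 < a) : mutualInfo P ≤ infoReal P a := by
  have ha : 0 < a := by linarith
  have h := (Real.le_log_iff_exp_le (mass_pos hP ha)).2 (exp_le_mass hP ha)
  have hk : 0 < a / (a - 1) := div_pos ha (by linarith)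
  have h2 := mul_le_mul_of_nonneg_left h hk.le
  have h1a' : (a - 1) ≠ 0 := by linarith
  have e1 : a / (a - 1) * ((a - 1) / a * mutualInfo P) = mutualInfo P := by field_simp
  rw [infoReal, if_neg ha1.ne']
  linarith

/-- Away from order one this is monotonicity of slopes from the fixed point `1`, reversed by both `a
↦ a⁻¹` and the sign. At order one the slope degenerates and Jensen's bound replaces it. -/
lemma infoReal_mono {a b : ℝ} (ha : 0 < a) (hab : a ≤ b) : infoReal P a ≤ infoReal P b := by
  have hb := ha.trans_le hab
  have e1 : infoReal P 1 = mutualInfo P := if_pos rfl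
  rcases eq_or_ne a 1 with rfl | ha1
  · rcases hab.eq_or_lt with rfl | h
    · rfl
    · rw [e1]
      exact mutualInfo_le_infoReal hP h
  rcases eq_or_ne b 1 with rfl | hb1
  · rw [e1]
    exact infoReal_le_mutualInfo hP ha (lt_of_le_of_ne hab ha1)
  rw [infoReal_eq_neg_slope hP ha ha1, infoReal_eq_neg_slope hP hb hb1, neg_le_neg_iff]
  refine (convexOn_log_mass hP).slope_mono (mem_Ioi.2 one_pos) ⟨inv_pos.2 hb, ?_⟩
    ⟨inv_pos.2 ha, ?_⟩ (inv_anti₀ ha hab)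
  · simpa using hb1
  · simpa using ha1

lemma infoReal_le_log_massTop {a : ℝ} (ha : 0 < a) : infoReal P a ≤ Real.log (massTop P) := by
  -- Raising the order above one makes the bound of the mass by `massTop` available.
  refine (infoReal_mono hP ha (le_max_left a 2)).trans ?_
  have h1 : 1 < max a 2 := lt_max_of_lt_right one_lt_two
  set b := max a 2
  have hb0 : 0 < b := by linarith
  have h := Real.log_le_log (mass_pos hP hb0) (mass_le_massTop_rpow hP h1)
  rw [Real.log_rpow (one_pos.trans_le (one_le_massTop hP))] at h
  rw [infoReal, if_neg h1.ne']
  have hk : 0 < b / (b - 1) := div_pos hb0 (by linarith)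
  have h2 := mul_le_mul_of_nonneg_left h hk.le
  have h1a' : (b - 1) ≠ 0 := by linarith
  have e1 : b / (b - 1) * ((b - 1) / b * Real.log (massTop P)) = Real.log (massTop P) := by
    field_simp
  linarith

/-- `(1 - a) / a` times the information is nonincreasing. -/
lemma mul_infoReal_anti {a b : ℝ} (ha : 0 < a) (hab : a ≤ b) (hb : b < 1) :
    (1 - b) / b * infoReal P b ≤ (1 - a) / a * infoReal P a := by
  have e : ∀ c : ℝ, 0 < c → c < 1 → (1 - c) / c * infoReal P c = -Real.log (mass P c) := by
    intro c hc hc1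
    have h1 : c - 1 ≠ 0 := by linarith
    rw [infoReal, if_neg hc1.ne]
    field_simp
    ring
  rw [e a ha (by linarith), e b (by linarith) hb, neg_le_neg_iff]
  exact Real.log_le_log (mass_pos hP ha) (mass_mono hP ha hab)

/-- `a - 1` times the information is convex on `(1, ∞)`. -/
lemma sub_one_mul_infoReal_le {α₀ α₁ a b : ℝ} (h₀ : 1 < α₀) (h₁ : 1 < α₁) (ha : 0 ≤ a)
    (hb : 0 ≤ b) (hab : a + b = 1) :
    (a * α₀ + b * α₁ - 1) * infoReal P (a * α₀ + b * α₁) ≤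
      a * ((α₀ - 1) * infoReal P α₀) + b * ((α₁ - 1) * infoReal P α₁) := by
  have e : ∀ c : ℝ, 1 < c → (c - 1) * infoReal P c = c * Real.log (mass P c) := by
    intro c hc
    have h1 : c - 1 ≠ 0 := by linarith
    rw [infoReal, if_neg hc.ne']
    field_simp
  have h1 : 1 < a * α₀ + b * α₁ := by
    rcases ha.eq_or_lt with rfl | ha
    · rw [zero_add] at hab
      rw [hab]; linarith
    · nlinarith
  rw [e _ h₀, e _ h₁, e _ h1]
  set α := a * α₀ + b * α₁ with hα
  have h0 : 0 < α := by linarith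
  have p0 : 0 < α₀ := by linarith
  have p1 : 0 < α₁ := by linarith
  have q0 : 0 ≤ a * α₀ / α := by positivity
  have q1 : 0 ≤ b * α₁ / α := by positivity
  -- The reciprocal of `α` is the average of those of `α₀` and `α₁` with weights `a α₀ / α` and `b
  -- α₁ / α`; multiplying by `α` clears them.
  have h := (convexOn_log_mass hP).2 (mem_Ioi.2 (inv_pos.2 p0)) (mem_Ioi.2 (inv_pos.2 p1)) q0 q1
    (by rw [← add_div, ← hα, div_self h0.ne'])
  simp only [smul_eq_mul, inv_inv] at h
  have e2 : a * α₀ / α * α₀⁻¹ + b * α₁ / α * α₁⁻¹ = α⁻¹ := by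
    field_simp
    exact hab
  rw [e2, inv_inv] at h
  calc α * Real.log (mass P α) ≤ α * _ := mul_le_mul_of_nonneg_left h h0.le
    _ = _ := by field_simp

/-- An upper bound on the information of order just above one, uniform in the prior. -/
lemma infoReal_one_add_le {r k d : ℝ} (hr : 1 < r) (hk : k = (r - 1) / r) (hd0 : 0 < d)
    (hd : d ≤ k / 2) :
    infoReal P (1 + d) ≤ (1 + d) * (mutualInfo P + d * (8 / k ^ 2 * (mass P r + 1))) := by
  have h := mass_one_add_le hP hr hk (by rwa [abs_of_pos hd0])
  have h2 := Real.log_le_sub_one_of_pos (mass_pos hP (by linarith : 0 < 1 + d))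
  rw [infoReal, if_neg (by linarith), add_sub_cancel_left]
  calc (1 + d) / d * Real.log (mass P (1 + d))
      ≤ (1 + d) / d * (d * mutualInfo P + d ^ 2 * (8 / k ^ 2) * (mass P r + 1)) := by
        gcongr; linarith
    _ = _ := by field_simp

/-- The expansion of the mass below order one: the factor `(1 + d) / d` is negative, so the upper
bound on the mass becomes a lower bound on the information. -/
lemma le_infoReal_one_add {r k d : ℝ} (hr : 1 < r) (hk : k = (r - 1) / r) (hd0 : d < 0)
    (hd1 : -1 < d) (hd : -d ≤ k / 2) :
    (1 + d) * (mutualInfo P + d * (8 / k ^ 2 * (mass P r + 1))) ≤ infoReal P (1 + d) := by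
  have h := mass_one_add_le hP hr hk (by rwa [abs_of_neg hd0])
  have h2 := Real.log_le_sub_one_of_pos (mass_pos hP (by linarith : 0 < 1 + d))
  rw [infoReal, if_neg (by linarith), add_sub_cancel_left]
  calc _ = (1 + d) / d * (d * mutualInfo P + d ^ 2 * (8 / k ^ 2) * (mass P r + 1)) := by
        have := hd0.ne
        field_simp
    _ ≤ _ := mul_le_mul_of_nonpos_left (by linarith)
        (div_nonpos_of_nonneg_of_nonpos (by linarith) hd0.le)

lemma exists_lt_infoReal {a y : ℝ} (ha : 0 < a) (hy : y < infoReal P a) :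
    ∃ b, 0 < b ∧ b < a ∧ y < infoReal P b := by
  rcases eq_or_ne a 1 with rfl | ha1
  · rw [infoReal, if_pos rfl] at hy
    -- The remainder constant for `r = 2`, where `k = 1 / 2`; the cap `1 / 4` on the step below is
    -- `k / 2`.
    set K := 8 / (1 / 2 : ℝ) ^ 2 * (mass P 2 + 1)
    have hc : ContinuousAt (fun d : ℝ => (1 + d) * (mutualInfo P + d * K)) 0 := by fun_prop
    have hev := hc.eventually_const_lt (u := y) (by simpa using hy)
    obtain ⟨e, he, hball⟩ := Metric.eventually_nhds_iff.1 hev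
    set d := -min (e / 2) (1 / 4) with hd
    have h1 : 0 < min (e / 2) (1 / 4) := by positivity
    have h2 : min (e / 2) (1 / 4) ≤ e / 2 := min_le_left _ _
    have h3 : min (e / 2) (1 / 4) ≤ 1 / 4 := min_le_right _ _
    refine ⟨1 + d, by linarith, by linarith, (hball ?_).trans_le
      (le_infoReal_one_add hP one_lt_two (by norm_num) (by linarith) (by linarith) (by linarith))⟩
    rw [Real.dist_eq, sub_zero, hd, abs_neg, abs_of_pos h1]
    linarith
  · have hc : ContinuousAt (fun b : ℝ => b / (b - 1) * Real.log (mass P b⁻¹⁻¹)) a := by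
      have h1 : ContinuousAt (fun t : ℝ => Real.log (mass P t⁻¹)) a⁻¹ :=
        ((convexOn_log_mass hP).continuousOn isOpen_Ioi).continuousAt (Ioi_mem_nhds (inv_pos.2 ha))
      have h2 : ContinuousAt (fun b : ℝ => Real.log (mass P b⁻¹⁻¹)) a :=
        ContinuousAt.comp (f := fun b : ℝ => b⁻¹) h1 (continuousAt_inv₀ ha.ne')
      have h3 : ContinuousAt (fun b : ℝ => b / (b - 1)) a :=
        continuousAt_id.div (by fun_prop) (sub_ne_zero.2 ha1)
      exact h3.mul h2
    simp only [inv_inv] at hc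
    rw [infoReal, if_neg ha1] at hy
    have hev := (hc.eventually_const_lt hy).and ((eventually_gt_nhds ha).and
      (eventually_ne_nhds ha1))
    obtain ⟨b, ⟨h1, h2, h3⟩, h4⟩ :=
      ((hev.filter_mono nhdsWithin_le_nhds).and (self_mem_nhdsWithin (s := Iio a))).exists
    refine ⟨b, h2, h4, ?_⟩
    rwa [infoReal, if_neg h3]

/-- With `c` the least weight, `c ^ (1 / b) * massTop P ≤ mass P b`, and `c ^ (1 / b)` tends to one.
The factor `b / (b - 1) ≥ 1` only helps, the mass being at least one. -/
lemma exists_lt_infoReal_of_top {y : ℝ} (hy : y < Real.log (massTop P)) :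
    ∃ b, 0 < b ∧ y < infoReal P b := by
  obtain ⟨c, hc, h⟩ := exists_pos_le_weight hP
  have hT := one_pos.trans_le (one_le_massTop hP)
  have hlim : Tendsto (fun b : ℝ => 1 / b * Real.log c + Real.log (massTop P)) atTop
      (𝓝 (0 * Real.log c + Real.log (massTop P))) := by
    have := tendsto_inv_atTop_zero (𝕜 := ℝ)
    simp only [one_div]
    exact (this.mul_const _).add_const _
  rw [zero_mul, zero_add] at hlim
  obtain ⟨b, h1, h2⟩ := ((hlim.eventually_const_lt hy).and (eventually_gt_atTop 1)).exists
  have hb0 : 0 < b := by linarith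
  refine ⟨b, hb0, h1.trans_le ?_⟩
  have h3 := Real.log_le_log (by positivity) (rpow_mul_massTop_le hP hb0 hc.le h)
  rw [Real.log_mul (by positivity) hT.ne', Real.log_rpow hc] at h3
  refine h3.trans ?_
  rw [infoReal, if_neg h2.ne']
  refine le_mul_of_one_le_left (Real.log_nonneg ?_) ((one_le_div (by linarith)).2 (by linarith))
  rw [← mass_one hP]
  exact mass_mono hP one_pos h2.le

end Prior
end

/-! ### The information on all of `[0, ∞]` -/

variable {Ω : Type*} [MeasurableSpace Ω] {P : ProbabilityMeasure Ω →₀ ℝ≥0}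

section Prior

variable (hP : ∑ W ∈ P.support, P W = 1)

include hP

lemma information_mono {α β : ℝ≥0∞} (h : α ≤ β) : information α P ≤ information β P := by
  have h0 : ∀ b : ℝ, 0 < b → information 0 P ≤ (infoReal P b : ℝ) := fun b hb => by
    -- The comparison with order zero is available only below order one.
    have hm : 0 < min b (1 / 2) := by positivity
    exact (information_zero_le hP hm ((min_le_right _ _).trans_lt (by norm_num))).trans
      (EReal.coe_le_coe_iff.2 (infoReal_mono hP hm (min_le_left _ _)))
  have hT : ∀ b : ℝ, 0 < b → ((infoReal P b : ℝ) : EReal) ≤ information ∞ P := fun b hb => by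
    rw [information_top hP]
    exact EReal.coe_le_coe_iff.2 (infoReal_le_log_massTop hP hb)
  rcases eq_or_ne β 0 with rfl | hβ
  · rw [nonpos_iff_eq_zero.1 h]
  rcases eq_or_ne α ∞ with rfl | hα
  · rw [top_le_iff.1 h]
  rcases eq_or_ne β ∞ with rfl | hβt
  · rcases eq_or_ne α 0 with rfl | hα0
    · exact (h0 1 one_pos).trans (hT 1 one_pos)
    · rw [← ENNReal.ofReal_toReal hα, information_ofReal hP (ENNReal.toReal_pos hα0 hα)]
      exact hT _ (ENNReal.toReal_pos hα0 hα)
  have hb := ENNReal.toReal_pos hβ hβt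
  rw [← ENNReal.ofReal_toReal hβt, information_ofReal hP hb]
  rcases eq_or_ne α 0 with rfl | hα0
  · exact h0 _ hb
  · have ha := ENNReal.toReal_pos hα0 hα
    rw [← ENNReal.ofReal_toReal hα, information_ofReal hP ha]
    exact EReal.coe_le_coe_iff.2 (infoReal_mono hP ha (ENNReal.toReal_mono hβt h))

lemma information_nonneg (α : ℝ≥0∞) : 0 ≤ information α P := by
  classical
  refine le_trans ?_ (information_mono hP (zero_le (a := α)))
  rw [information, if_pos rfl]
  refine le_essInf_of_ae_le _ (Eventually.of_forall fun y => ?_)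
  rw [← ENNReal.log_one]
  refine ENNReal.log_monotone ?_
  rw [one_div, ENNReal.one_le_inv]
  calc _ ≤ ∑ W ∈ P.support, (P W : ℝ≥0∞) := Finset.sum_le_sum fun W _ => by
        split_ifs
        exacts [le_rfl, zero_le]
    _ = 1 := by exact_mod_cast hP

lemma exists_lt_information {α : ℝ≥0∞} (hα : α ≠ 0) {y : EReal} (hy : y < information α P) :
    ∃ β < α, y < information β P := by
  obtain ⟨z, hyz, hz⟩ : ∃ z : ℝ, y ≤ z ∧ (z : EReal) < information α P := by
    obtain ⟨z, h1, h2⟩ := EReal.lt_iff_exists_real_btwn.1 hy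
    exact ⟨z, h1.le, h2⟩
  rcases eq_or_ne α ∞ with rfl | hαt
  · rw [information_top hP, EReal.coe_lt_coe_iff] at hz
    obtain ⟨b, hb, h⟩ := exists_lt_infoReal_of_top hP hz
    refine ⟨ENNReal.ofReal b, ENNReal.ofReal_lt_top, hyz.trans_lt ?_⟩
    rw [information_ofReal hP hb]
    exact EReal.coe_lt_coe_iff.2 h
  · have ha := ENNReal.toReal_pos hα hαt
    rw [← ENNReal.ofReal_toReal hαt, information_ofReal hP ha, EReal.coe_lt_coe_iff] at hz
    obtain ⟨b, hb, hba, h⟩ := exists_lt_infoReal hP ha hz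
    refine ⟨ENNReal.ofReal b, (ENNReal.ofReal_lt_iff_lt_toReal hb.le hαt).2 hba,
      hyz.trans_lt ?_⟩
    rw [information_ofReal hP hb]
    exact EReal.coe_lt_coe_iff.2 h

end Prior

/-! ### The capacity -/

variable {𝒲 : Set (ProbabilityMeasure Ω)}

lemma information_le_capacity (α : ℝ≥0∞) (hP : P ∈ priors 𝒲) :
    information α P ≤ capacity α 𝒲 :=
  le_iSup₂ (f := fun P (_ : P ∈ priors 𝒲) => information α P) P hP

lemma exists_of_lt_capacity {α : ℝ≥0∞} {y : EReal} (h : y < capacity α 𝒲) :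
    ∃ P ∈ priors 𝒲, y < information α P := by
  simpa [capacity, lt_iSup_iff] using h

lemma capacity_mono : Monotone fun α : ℝ≥0∞ => capacity α 𝒲 := fun _ _ h =>
  iSup₂_mono fun _ hP => information_mono hP.1 h

lemma capacity_mono_set (α : ℝ≥0∞) {𝒱 : Set (ProbabilityMeasure Ω)} (h : 𝒱 ⊆ 𝒲) :
    capacity α 𝒱 ≤ capacity α 𝒲 :=
  iSup₂_le fun _ hP => information_le_capacity α ⟨hP.1, hP.2.trans h⟩

/-- A point mass is a prior, which keeps the supremum away from `⊥`. -/
lemma capacity_nonneg (h𝒲 : 𝒲.Nonempty) (α : ℝ≥0∞) : 0 ≤ capacity α 𝒲 := by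
  obtain ⟨W, hW⟩ := h𝒲
  have h : Finsupp.single W (1 : ℝ≥0) ∈ priors 𝒲 := by
    rw [priors, mem_ofPred_eq, Finsupp.support_single _ one_ne_zero]
    simpa using hW
  exact (information_nonneg h.1 α).trans (information_le_capacity α h)

lemma exists_lt_capacity {α : ℝ≥0∞} (hα : α ≠ 0) {y : EReal} (hy : y < capacity α 𝒲) :
    ∃ β < α, y < capacity β 𝒲 := by
  obtain ⟨P, hP, h⟩ := exists_of_lt_capacity hy
  obtain ⟨β, hβ, h2⟩ := exists_lt_information hP.1 hα h
  exact ⟨β, hβ, h2.trans_le (information_le_capacity β hP)⟩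

lemma lowerSemicontinuous_capacity : LowerSemicontinuous fun α : ℝ≥0∞ => capacity α 𝒲 := by
  intro α y hy
  rcases eq_or_ne α 0 with rfl | hα
  · exact Eventually.of_forall fun β => hy.trans_le (capacity_mono (zero_le (a := β)))
  · obtain ⟨β, hβ, h⟩ := exists_lt_capacity hα hy
    filter_upwards [Ioi_mem_nhds hβ] with γ hγ
    exact h.trans_le (capacity_mono (le_of_lt hγ))

lemma capacity_ofReal_le_coe_iff {a c : ℝ} (ha : 0 < a) :
    capacity (ENNReal.ofReal a) 𝒲 ≤ c ↔ ∀ P ∈ priors 𝒲, infoReal P a ≤ c := by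
  simp only [capacity, iSup_le_iff]
  refine forall₂_congr fun P hP => ?_
  rw [information_ofReal hP.1 ha, EReal.coe_le_coe_iff]

lemma exists_capacity_eq_coe (h𝒲 : 𝒲.Nonempty) {α : ℝ≥0∞} (h : capacity α 𝒲 < ⊤) :
    ∃ c : ℝ, 0 ≤ c ∧ capacity α 𝒲 = c := by
  have h0 := capacity_nonneg h𝒲 α
  lift capacity α 𝒲 to ℝ using ⟨h.ne, fun hb => by simp [hb] at h0⟩ with c
  exact ⟨c, by exact_mod_cast h0, rfl⟩

lemma mul_capacity_anti {a b c : ℝ} (ha : 0 < a) (hab : a ≤ b) (hb : b < 1)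
    (hc : capacity (ENNReal.ofReal a) 𝒲 = c) :
    capacity (ENNReal.ofReal b) 𝒲 ≤ ((b / (1 - b) * ((1 - a) / a * c) : ℝ) : EReal) := by
  have hb0 : 0 < b := ha.trans_le hab
  have hb1 : 1 - b ≠ 0 := by linarith
  refine (capacity_ofReal_le_coe_iff hb0).2 fun P hP => ?_
  have h1 := (capacity_ofReal_le_coe_iff ha).1 hc.le P hP
  have h2 := mul_infoReal_anti hP.1 ha hab hb
  have k1 : 0 ≤ b / (1 - b) := div_nonneg hb0.le (by linarith)
  have k2 : 0 ≤ (1 - a) / a := div_nonneg (by linarith) ha.le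
  calc infoReal P b = b / (1 - b) * ((1 - b) / b * infoReal P b) := by field_simp
    _ ≤ b / (1 - b) * ((1 - a) / a * c) :=
      mul_le_mul_of_nonneg_left (h2.trans (mul_le_mul_of_nonneg_left h1 k2)) k1

lemma exists_gt_of_continuousAt {u : ℝ → ℝ} {a r y : ℝ} (hu : ContinuousAt u a) (hy : u a < y)
    (hr : a < r) : ∃ b, a < b ∧ b < r ∧ u b < y := by
  obtain ⟨b, ⟨h1, h2⟩, h3⟩ := ((((hu.eventually_lt_const hy).and
    (eventually_lt_nhds hr)).filter_mono nhdsWithin_le_nhds).and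
      (self_mem_nhdsWithin (s := Ioi a))).exists
  exact ⟨b, h3, h2, h1⟩

/-- In each range of `a` there is an upper bound for the capacity at `b > a`, continuous in `b` and
equal to `c` at `b = a`. -/
lemma exists_capacity_ofReal_lt {a r c q y : ℝ} (ha : 0 < a) (har : a < r)
    (hc : capacity (ENNReal.ofReal a) 𝒲 = c)
    (hq : capacity (ENNReal.ofReal r) 𝒲 = q) (hy : c < y) :
    ∃ b, a < b ∧ capacity (ENNReal.ofReal b) 𝒲 < y := by
  have hca := (capacity_ofReal_le_coe_iff ha).1 hc.le
  have hqr := (capacity_ofReal_le_coe_iff (ha.trans har)).1 hq.le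
  rcases lt_trichotomy a 1 with h | rfl | h
  · have h1a : 1 - a ≠ 0 := by linarith
    obtain ⟨b, hab, hb, hlt⟩ := exists_gt_of_continuousAt
      (u := fun b => b / (1 - b) * ((1 - a) / a * c)) (a := a) (y := y)
      ((continuousAt_id.div (by fun_prop) h1a).mul continuousAt_const)
      (by
        have : a / (1 - a) * ((1 - a) / a * c) = c := by field_simp
        rwa [this]) h
    exact ⟨b, hab, (mul_capacity_anti ha hab.le hb hc).trans_lt (EReal.coe_lt_coe_iff.2 hlt)⟩
  · set k := (r - 1) / r with hk
    have hk0 : 0 < k := div_pos (by linarith) (by linarith)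
    set K := 8 / k ^ 2 * (Real.exp (k * q) + 1)
    obtain ⟨d, hd, hdk, hlt⟩ := exists_gt_of_continuousAt (u := fun d => (1 + d) * (c + d * K))
      (a := 0) (y := y) (by fun_prop) (by simpa using hy) (half_pos hk0)
    refine ⟨1 + d, by linarith, lt_of_le_of_lt ?_ (EReal.coe_lt_coe_iff.2 hlt)⟩
    refine (capacity_ofReal_le_coe_iff (by linarith)).2 fun P hP => ?_
    refine (infoReal_one_add_le hP.1 har hk hd hdk.le).trans ?_
    have h1 := hca P hP
    rw [infoReal, if_pos rfl] at h1
    -- Finite capacity at `r` bounds the mass of order `r`, hence the remainder, uniformly in the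
    -- prior.
    have h2 : mass P r ≤ Real.exp (k * q) := by
      rw [← Real.log_le_iff_le_exp (mass_pos hP.1 (by linarith))]
      have h3 := mul_le_mul_of_nonneg_left (hqr P hP) hk0.le
      rw [infoReal, if_neg har.ne'] at h3
      have hr1 : r - 1 ≠ 0 := by linarith
      have hr0 : r ≠ 0 := by linarith
      have e : k * (r / (r - 1) * Real.log (mass P r)) = Real.log (mass P r) := by
        rw [hk]; field_simp
      rwa [e] at h3
    show _ ≤ (1 + d) * (c + d * (8 / k ^ 2 * (Real.exp (k * q) + 1)))
    gcongr
  · have hra : r - a ≠ 0 := by linarith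
    have ha1 : a - 1 ≠ 0 := by linarith
    -- The chord of the convex function `(α - 1) C_α` between `a` and `r`, divided by `b - 1`.
    obtain ⟨b, hab, hb, hlt⟩ := exists_gt_of_continuousAt
      (u := fun b => ((r - b) / (r - a) * ((a - 1) * c) + (b - a) / (r - a) * ((r - 1) * q)) /
        (b - 1)) (a := a) (y := y) (by
          refine ContinuousAt.div ?_ (by fun_prop) ha1
          fun_prop)
      (by
        have : ((r - a) / (r - a) * ((a - 1) * c) + (a - a) / (r - a) * ((r - 1) * q)) /
          (a - 1) = c := by field_simp; ring
        rwa [this]) har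
    refine ⟨b, hab, lt_of_le_of_lt ?_ (EReal.coe_lt_coe_iff.2 hlt)⟩
    refine (capacity_ofReal_le_coe_iff (by linarith)).2 fun P hP => ?_
    have hra' : 0 < r - a := by linarith
    have p0 : 0 ≤ (r - b) / (r - a) := div_nonneg (by linarith) hra'.le
    have p1 : 0 ≤ (b - a) / (r - a) := div_nonneg (by linarith) hra'.le
    have h3 := sub_one_mul_infoReal_le hP.1 h (h.trans har) p0 p1 (by field_simp; ring)
    have e : (r - b) / (r - a) * a + (b - a) / (r - a) * r = b := by field_simp; ring
    rw [e] at h3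
    rw [le_div_iff₀ (by linarith), mul_comm]
    refine h3.trans ?_
    have h4 := mul_le_mul_of_nonneg_left (hca P hP) (by linarith : 0 ≤ a - 1)
    have h5 := mul_le_mul_of_nonneg_left (hqr P hP) (by linarith : 0 ≤ r - 1)
    exact add_le_add (mul_le_mul_of_nonneg_left h4 p0) (mul_le_mul_of_nonneg_left h5 p1)

/-- Finiteness at a larger order makes the capacity right continuous. -/
lemma exists_capacity_lt (h𝒲 : 𝒲.Nonempty) {α θ : ℝ≥0∞} (hα : 0 < α) (hαθ : α < θ)
    (hθ : capacity θ 𝒲 < ⊤) {y : EReal} (hy : capacity α 𝒲 < y) :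
    ∃ β > α, capacity β 𝒲 < y := by
  obtain ⟨r, hr, hrθ⟩ := ENNReal.lt_iff_exists_real_btwn.1 hαθ |>.imp fun _ h => h.2
  have hαt : α ≠ ∞ := hαθ.ne_top
  have ha := ENNReal.toReal_pos hα.ne' hαt
  have har : α.toReal < r := (ENNReal.lt_ofReal_iff_toReal_lt hαt).1 hr
  obtain ⟨c, -, hc⟩ := exists_capacity_eq_coe h𝒲 ((capacity_mono hαθ.le).trans_lt hθ)
  obtain ⟨q, -, hq⟩ := exists_capacity_eq_coe h𝒲 ((capacity_mono hrθ.le).trans_lt hθ)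
  obtain ⟨z, hz, hzy⟩ := EReal.lt_iff_exists_real_btwn.1 hy
  rw [hc, EReal.coe_lt_coe_iff] at hz
  rw [← ENNReal.ofReal_toReal hαt] at hc
  obtain ⟨b, hab, h⟩ := exists_capacity_ofReal_lt ha har hc hq hz
  exact ⟨ENNReal.ofReal b, (ENNReal.lt_ofReal_iff_toReal_lt hαt).2 hab, h.trans hzy⟩

/-- Lower semicontinuity gives the lower half and monotonicity spreads the bound at `β` to all
smaller orders. At `θ` only orders from the left matter, so no condition is needed there. -/
lemma continuousOn_capacity {θ : ℝ≥0∞}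
    (h : ∀ α, 0 < α → α < θ → ∀ y, capacity α 𝒲 < y → ∃ β > α, capacity β 𝒲 < y) :
    ContinuousOn (fun α : ℝ≥0∞ => capacity α 𝒲) (Ioc 0 θ) := by
  intro α hα
  refine tendsto_order.2 ⟨fun y hy => ?_, fun y hy => ?_⟩
  · exact (lowerSemicontinuous_capacity α y hy).filter_mono nhdsWithin_le_nhds
  · rcases hα.2.eq_or_lt with rfl | hlt
    · filter_upwards [self_mem_nhdsWithin] with β hβ
      exact (capacity_mono hβ.2).trans_lt hy
    · obtain ⟨β, hβ, hb⟩ := h α hα.1 hlt y hy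
      filter_upwards [mem_nhdsWithin_of_mem_nhds (Iio_mem_nhds hβ)] with γ hγ
      exact (capacity_mono (le_of_lt hγ)).trans_lt hb

lemma continuousOn_capacity_of_lt_top (h𝒲 : 𝒲.Nonempty) {θ : ℝ≥0∞} (hθ : capacity θ 𝒲 < ⊤) :
    ContinuousOn (fun α : ℝ≥0∞ => capacity α 𝒲) (Ioc 0 θ) :=
  continuousOn_capacity fun _ hα hαθ _ hy => exists_capacity_lt h𝒲 hα hαθ hθ hy

lemma capacity_lt_top_of_lt_one (h𝒲 : 𝒲.Nonempty) {θ α : ℝ≥0∞} (hθ0 : 0 < θ)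
    (hθ : capacity θ 𝒲 < ⊤) (hα : α < 1) : capacity α 𝒲 < ⊤ := by
  rcases le_total α θ with h | h
  · exact (capacity_mono h).trans_lt hθ
  · obtain ⟨c, -, hc⟩ := exists_capacity_eq_coe h𝒲 hθ
    have hαt : α ≠ ∞ := hα.ne_top
    have hθt : θ ≠ ∞ := (h.trans_lt hα).ne_top
    rw [← ENNReal.ofReal_toReal hθt] at hc
    have h1 : α.toReal < 1 := by
      rw [← ENNReal.toReal_one]
      exact (ENNReal.toReal_lt_toReal hαt ENNReal.one_ne_top).2 hα
    have h2 := mul_capacity_anti (ENNReal.toReal_pos hθ0.ne' hθt) (ENNReal.toReal_mono hαt h)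
      h1 hc
    rw [ENNReal.ofReal_toReal hαt] at h2
    exact h2.trans_lt (EReal.coe_lt_top _)

lemma continuousOn_capacity_Ioc_one (h𝒲 : 𝒲.Nonempty) :
    ContinuousOn (fun α : ℝ≥0∞ => capacity α 𝒲) (Ioc 0 1) :=
  continuousOn_capacity fun α hα hα1 y hy => by
    obtain ⟨β, hαβ, hβ⟩ := exists_between hα1
    exact exists_capacity_lt h𝒲 hα hαβ
      (capacity_lt_top_of_lt_one h𝒲 hα (hy.trans_le le_top) hβ) hy

lemma exists_countable_capacity_eq (𝒲 : Set (ProbabilityMeasure Ω)) :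
    ∃ 𝒱 ⊆ 𝒲, 𝒱.Countable ∧ ∀ α : ℝ≥0∞, capacity α 𝒱 = capacity α 𝒲 := by
  obtain ⟨D, hDc, hD⟩ := TopologicalSpace.exists_countable_dense ℝ≥0∞
  obtain ⟨E, hEc, hE⟩ := TopologicalSpace.exists_countable_dense EReal
  have hch : ∀ z : ℝ≥0∞ × EReal, ∃ P : ProbabilityMeasure Ω →₀ ℝ≥0,
      z.2 < capacity z.1 𝒲 → P ∈ priors 𝒲 ∧ z.2 < information z.1 P := fun z => by
    by_cases h : z.2 < capacity z.1 𝒲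
    · obtain ⟨P, hP⟩ := exists_of_lt_capacity h
      exact ⟨P, fun _ => hP⟩
    · exact ⟨0, fun h' => absurd h' h⟩
  choose Q hQ using hch
  -- One prior is kept for each pair of an order and a level from countable dense sets. Order zero
  -- is added by hand, having no smaller order to approximate it.
  set I : Set (ℝ≥0∞ × EReal) := {z ∈ insert 0 D ×ˢ E | z.2 < capacity z.1 𝒲}
  have hI : I.Countable := ((hDc.insert 0).prod hEc).mono (sep_subset _ _)
  set 𝒱 : Set (ProbabilityMeasure Ω) := ⋃ z ∈ I, ((Q z).support : Set (ProbabilityMeasure Ω))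
  have hsub : 𝒱 ⊆ 𝒲 := iUnion₂_subset fun z hz => (hQ z hz.2).1.2
  refine ⟨𝒱, hsub, hI.biUnion fun z _ => (Q z).support.countable_toSet, fun α =>
    le_antisymm (capacity_mono_set α hsub) (le_of_forall_lt fun y hy => ?_)⟩
  obtain ⟨q, hqD, hqα, hq⟩ : ∃ q ∈ insert 0 D, q ≤ α ∧ y < capacity q 𝒲 := by
    rcases eq_or_ne α 0 with rfl | hα
    · exact ⟨0, mem_insert _ _, le_rfl, hy⟩
    · obtain ⟨β, hβ, h⟩ := exists_lt_capacity hα hy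
      obtain ⟨q, hq, h1, h2⟩ := hD.exists_between hβ
      exact ⟨q, mem_insert_of_mem _ hq, h2.le, h.trans_le (capacity_mono h1.le)⟩
  obtain ⟨d, hd, hyd, hdq⟩ := hE.exists_between hq
  have hz : (q, d) ∈ I := ⟨⟨hqD, hd⟩, hdq⟩
  have hp : Q (q, d) ∈ priors 𝒱 := ⟨(hQ (q, d) hdq).1.1, subset_biUnion_of_mem
    (u := fun z => ((Q z).support : Set (ProbabilityMeasure Ω))) hz⟩
  exact hyd.trans ((hQ (q, d) hdq).2.trans_le
    ((information_le_capacity q hp).trans (capacity_mono hqα)))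

/-- Near each `α` the support of one nearly optimal prior suffices: its capacity stays above `c - ε
/ 3` by lower semicontinuity, while that of `𝒲` stays below `c + ε / 3` by continuity. Compactness
leaves finitely many supports. -/
lemma exists_finite_capacity_gt (h𝒲 : 𝒲.Nonempty) {θ : ℝ≥0∞} (hθ : capacity θ 𝒲 < ⊤) {ε : ℝ}
    (hε : 0 < ε) : ∃ 𝒱 ⊆ 𝒲, 𝒱.Finite ∧ ∀ α ∈ Icc (ENNReal.ofReal ε) θ,
      capacity α 𝒲 - (ε : EReal) < capacity α 𝒱 := by
  refine isCompact_Icc.induction_on (s := Icc (ENNReal.ofReal ε) θ)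
    (p := fun s => ∃ 𝒱 ⊆ 𝒲, 𝒱.Finite ∧ ∀ α ∈ s, capacity α 𝒲 - (ε : EReal) < capacity α 𝒱)
    ⟨∅, empty_subset _, finite_empty, by simp⟩ ?_ ?_ fun α hα => ?_
  · rintro s t hst ⟨𝒱, h1, h2, h3⟩
    exact ⟨𝒱, h1, h2, fun α hα => h3 α (hst hα)⟩
  · rintro s t ⟨𝒱, h1, h2, h3⟩ ⟨𝒱', h1', h2', h3'⟩
    refine ⟨𝒱 ∪ 𝒱', union_subset h1 h1', h2.union h2', fun α hα => ?_⟩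
    rcases hα with hα | hα
    · exact (h3 α hα).trans_le (capacity_mono_set α subset_union_left)
    · exact (h3' α hα).trans_le (capacity_mono_set α subset_union_right)
  have hK : Icc (ENNReal.ofReal ε) θ ⊆ Ioc 0 θ := fun β hβ =>
    ⟨(ENNReal.ofReal_pos.2 hε).trans_le hβ.1, hβ.2⟩
  obtain ⟨c, -, hc⟩ := exists_capacity_eq_coe h𝒲 ((capacity_mono hα.2).trans_lt hθ)
  have hlow : ((c - ε / 3 : ℝ) : EReal) < capacity α 𝒲 := by
    rw [hc, EReal.coe_lt_coe_iff]; linarith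
  obtain ⟨P, hP, hlt⟩ := exists_of_lt_capacity hlow
  have hP' : P ∈ priors (P.support : Set (ProbabilityMeasure Ω)) := ⟨hP.1, subset_rfl⟩
  have hhigh : capacity α 𝒲 < ((c + ε / 3 : ℝ) : EReal) := by
    rw [hc, EReal.coe_lt_coe_iff]; linarith
  have hev := (((continuousOn_capacity_of_lt_top h𝒲 hθ).mono hK) α hα).eventually_lt_const hhigh
  have hev2 := (lowerSemicontinuous_capacity α _
    (hlt.trans_le (information_le_capacity α hP'))).filter_mono
      (nhdsWithin_le_nhds (s := Icc (ENNReal.ofReal ε) θ))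
  refine ⟨_, hev.and (hev2.and self_mem_nhdsWithin), _, hP.2, P.support.finite_toSet, ?_⟩
  rintro β ⟨h1, h2, h3⟩
  obtain ⟨b, -, hb⟩ := exists_capacity_eq_coe h𝒲 ((capacity_mono h3.2).trans_lt hθ)
  rw [hb, EReal.coe_lt_coe_iff] at h1
  refine lt_trans ?_ h2
  rw [hb, ← EReal.coe_sub, EReal.coe_lt_coe_iff]
  linarith

lemma sub_one_mul_capacity_le (h𝒲 : 𝒲.Nonempty) {α₀ α₁ a b : ℝ} (h₀ : 1 < α₀) (h₁ : 1 < α₁)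
    (ha : 0 ≤ a) (hb : 0 ≤ b) (hab : a + b = 1) :
    ((a * α₀ + b * α₁ - 1 : ℝ) : EReal) * capacity (ENNReal.ofReal (a * α₀ + b * α₁)) 𝒲 ≤
      (a : EReal) * (((α₀ - 1 : ℝ) : EReal) * capacity (ENNReal.ofReal α₀) 𝒲) +
      (b : EReal) * (((α₁ - 1 : ℝ) : EReal) * capacity (ENNReal.ofReal α₁) 𝒲) := by
  -- Zero weights are treated apart because `0 * ⊤ = 0` in `EReal`; with positive weights an
  -- infinite capacity at either end makes the right side `⊤`.
  rcases ha.eq_or_lt with rfl | ha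
  · obtain rfl : b = 1 := by linarith
    simp
  rcases hb.eq_or_lt with rfl | hb
  · obtain rfl : a = 1 := by linarith
    simp
  have hn : ∀ e α : ℝ, 0 < e → 1 < α →
      0 ≤ (e : EReal) * (((α - 1 : ℝ) : EReal) * capacity (ENNReal.ofReal α) 𝒲) :=
    fun e α he hα => mul_nonneg (EReal.coe_nonneg.2 he.le)
      (mul_nonneg (EReal.coe_nonneg.2 (by linarith)) (capacity_nonneg h𝒲 _))
  have hbot : ∀ e α : ℝ, 0 < e → 1 < α →
      (e : EReal) * (((α - 1 : ℝ) : EReal) * capacity (ENNReal.ofReal α) 𝒲) ≠ ⊥ :=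
    fun e α he hα => (EReal.bot_lt_zero.trans_le (hn e α he hα)).ne'
  rcases eq_or_ne (capacity (ENNReal.ofReal α₀) 𝒲) ⊤ with h | hf₀
  · have h2 := hbot b α₁ hb h₁
    rw [h, EReal.coe_mul_top_of_pos (by linarith), EReal.coe_mul_top_of_pos ha,
      EReal.top_add_of_ne_bot h2]
    exact le_top
  rcases eq_or_ne (capacity (ENNReal.ofReal α₁) 𝒲) ⊤ with h | hf₁
  · have h2 := hbot a α₀ ha h₀
    rw [h, EReal.coe_mul_top_of_pos (by linarith), EReal.coe_mul_top_of_pos hb,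
      EReal.add_top_of_ne_bot h2]
    exact le_top
  obtain ⟨c, -, hc⟩ := exists_capacity_eq_coe h𝒲 hf₀.lt_top
  obtain ⟨q, -, hq⟩ := exists_capacity_eq_coe h𝒲 hf₁.lt_top
  have h1 : 1 < a * α₀ + b * α₁ := by nlinarith
  set α := a * α₀ + b * α₁
  have hα : 0 < α - 1 := by linarith
  have hle : capacity (ENNReal.ofReal α) 𝒲 ≤
      (((a * ((α₀ - 1) * c) + b * ((α₁ - 1) * q)) / (α - 1) : ℝ) : EReal) := by
    refine (capacity_ofReal_le_coe_iff (by linarith)).2 fun P hP => ?_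
    rw [le_div_iff₀ hα, mul_comm]
    refine (sub_one_mul_infoReal_le hP.1 h₀ h₁ ha.le hb.le hab).trans ?_
    have h4 := mul_le_mul_of_nonneg_left
      ((capacity_ofReal_le_coe_iff (by linarith)).1 hc.le P hP) (by linarith : 0 ≤ α₀ - 1)
    have h5 := mul_le_mul_of_nonneg_left
      ((capacity_ofReal_le_coe_iff (by linarith)).1 hq.le P hP) (by linarith : 0 ≤ α₁ - 1)
    exact add_le_add (mul_le_mul_of_nonneg_left h4 ha.le) (mul_le_mul_of_nonneg_left h5 hb.le)
  refine (mul_le_mul_of_nonneg_left hle (EReal.coe_nonneg.2 hα.le)).trans_eq ?_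
  rw [hc, hq]
  norm_cast
  field_simp

lemma antitoneOn_mul_capacity (h𝒲 : 𝒲.Nonempty) :
    AntitoneOn (fun α : ℝ =>
      (((1 - α) / α : ℝ) : EReal) * capacity (ENNReal.ofReal α) 𝒲) (Ioo 0 1) := by
  intro a ha b hb hab
  have ka : 0 < (1 - a) / a := div_pos (by linarith [ha.2]) ha.1
  have kb : 0 < (1 - b) / b := div_pos (by linarith [hb.2]) hb.1
  show (((1 - b) / b : ℝ) : EReal) * capacity (ENNReal.ofReal b) 𝒲 ≤
    (((1 - a) / a : ℝ) : EReal) * capacity (ENNReal.ofReal a) 𝒲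
  rcases eq_or_ne (capacity (ENNReal.ofReal a) 𝒲) ⊤ with h | h
  · rw [h, EReal.coe_mul_top_of_pos ka]
    exact le_top
  obtain ⟨c, -, hc⟩ := exists_capacity_eq_coe h𝒲 h.lt_top
  have h1 := mul_capacity_anti ha.1 hab hb.2 hc
  refine (mul_le_mul_of_nonneg_left h1 (EReal.coe_nonneg.2 kb.le)).trans_eq ?_
  rw [hc, ← EReal.coe_mul, ← EReal.coe_mul]
  have := hb.1
  have := hb.2
  have h1b : 1 - b ≠ 0 := by linarith
  congr 1
  field_simp

lemma continuousOn_mul_capacity (h𝒲 : 𝒲.Nonempty) :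
    ContinuousOn (fun α : ℝ =>
      (((1 - α) / α : ℝ) : EReal) * capacity (ENNReal.ofReal α) 𝒲) (Ioo 0 1) := by
  intro a ha
  have ka : 0 < (1 - a) / a := div_pos (by linarith [ha.2]) ha.1
  have h1 : ContinuousWithinAt (fun α : ℝ => (((1 - α) / α : ℝ) : EReal)) (Ioo 0 1) a := by
    have : ContinuousAt (fun α : ℝ => (1 - α) / α) a :=
      ContinuousAt.div (by fun_prop) continuousAt_id ha.1.ne'
    exact (continuous_coe_real_ereal.continuousAt.comp this).continuousWithinAt
  have hmaps : MapsTo ENNReal.ofReal (Ioo 0 1) (Ioc 0 1) := fun b hb =>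
    ⟨ENNReal.ofReal_pos.2 hb.1, ENNReal.ofReal_le_one.2 hb.2.le⟩
  have h2 : ContinuousWithinAt (fun α : ℝ => capacity (ENNReal.ofReal α) 𝒲) (Ioo 0 1) a :=
    (continuousOn_capacity_Ioc_one h𝒲).comp ENNReal.continuous_ofReal.continuousOn hmaps a ha
  have hk0 : (((1 - a) / a : ℝ) : EReal) ≠ 0 := by exact_mod_cast ka.ne'
  -- The coefficient is real and nonzero, so the product avoids the discontinuities of `EReal`
  -- multiplication even where the capacity is infinite.
  exact (EReal.continuousAt_mul (p := ((((1 - a) / a : ℝ) : EReal),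
    capacity (ENNReal.ofReal a) 𝒲)) (Or.inl hk0) (Or.inl hk0) (Or.inl (EReal.coe_ne_bot _))
      (Or.inl (EReal.coe_ne_top _))).tendsto.comp (h1.prodMk_nhds h2)

lemma continuousOn_or_exists_discontinuity (h𝒲 : 𝒲.Nonempty) :
    ContinuousOn (fun α : ℝ≥0∞ => capacity α 𝒲) (Ioc 0 ∞) ∨
      ∃ φ ∈ Ico (1 : ℝ≥0∞) ∞,
        (∃ M : ℝ, ∀ α ∈ Ioc 0 φ, capacity α 𝒲 ≤ M) ∧
        ContinuousOn (fun α : ℝ≥0∞ => capacity α 𝒲) (Ioc 0 φ) ∧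
        (∀ α ∈ Ioc φ ∞, capacity α 𝒲 = ⊤) ∧
        (∀ α ∈ Ioc (0 : ℝ≥0∞) ∞, α ≠ φ → ContinuousAt (fun α : ℝ≥0∞ => capacity α 𝒲) α) ∧
        ¬ ContinuousAt (fun α : ℝ≥0∞ => capacity α 𝒲) φ := by
  by_cases h : ∀ α, 0 < α → α < ∞ → ∀ y, capacity α 𝒲 < y → ∃ β > α, capacity β 𝒲 < y
  · exact Or.inl (continuousOn_capacity h)
  push Not at h
  obtain ⟨φ, hφ0, hφt, y, hy, hgt⟩ := h
  have hfin : capacity φ 𝒲 < ⊤ := hy.trans_le le_top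
  -- A finite value beyond `φ` would restore right continuity at `φ`.
  have htop : ∀ α ∈ Ioc φ ∞, capacity α 𝒲 = ⊤ := fun α hα => by
    by_contra hne
    obtain ⟨β, hβ, hlt⟩ := exists_capacity_lt h𝒲 hφ0 hα.1 (lt_top_iff_ne_top.2 hne) hy
    exact (hgt β hβ).not_gt hlt
  have hcont := continuousOn_capacity_of_lt_top h𝒲 hfin
  refine Or.inr ⟨φ, ⟨?_, hφt⟩, ?_, hcont, htop, fun α hα hne => ?_, fun hc => ?_⟩
  -- If `φ < 1`, finiteness at `φ` would spread to all orders below one, some of which exceed `φ`.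
  · by_contra! hlt
    obtain ⟨β, hβ, hβ1⟩ := exists_between hlt
    exact (capacity_lt_top_of_lt_one h𝒲 hφ0 hfin hβ1).ne (htop β ⟨hβ, le_top⟩)
  · obtain ⟨c, -, hc⟩ := exists_capacity_eq_coe h𝒲 hfin
    exact ⟨c, fun α hα => (capacity_mono hα.2).trans_eq hc⟩
  · rcases hne.lt_or_gt with h | h
    · exact hcont.continuousAt (Ioc_mem_nhds hα.1 h)
    · refine (continuousAt_const (y := (⊤ : EReal))).congr ?_
      filter_upwards [Ioi_mem_nhds h] with β hβ
      exact (htop β ⟨hβ, le_top⟩).symm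
  · have hev := hc.eventually_lt_const hy
    have : (𝓝[>] φ).NeBot := nhdsGT_neBot_of_exists_gt ⟨∞, hφt⟩
    obtain ⟨β, h1, h2⟩ := ((hev.filter_mono nhdsWithin_le_nhds).and
      (self_mem_nhdsWithin (s := Ioi φ))).exists
    exact (hgt β h2).not_gt h1

end Renyi

theorem mainTheorem4 {Ω : Type*} [MeasurableSpace Ω] (𝒲 : Set (ProbabilityMeasure Ω))
    (h𝒲 : 𝒲.Nonempty) :
    -- monotonicity and lower semicontinuity on `[0, ∞]`
    (Monotone (fun α : ℝ≥0∞ => Renyi.capacity α 𝒲) ∧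
      LowerSemicontinuous (fun α : ℝ≥0∞ => Renyi.capacity α 𝒲)) ∧
    -- a countable subset with the same capacity at all orders
    (∃ 𝒲' ⊆ 𝒲, 𝒲'.Countable ∧ ∀ α : ℝ≥0∞, Renyi.capacity α 𝒲' = Renyi.capacity α 𝒲) ∧
    -- orders in `(0, 1]`
    (AntitoneOn (fun α : ℝ =>
        (((1 - α) / α : ℝ) : EReal) * Renyi.capacity (ENNReal.ofReal α) 𝒲) (Ioo 0 1) ∧
      ContinuousOn (fun α : ℝ =>
        (((1 - α) / α : ℝ) : EReal) * Renyi.capacity (ENNReal.ofReal α) 𝒲) (Ioo 0 1) ∧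
      ContinuousOn (fun α : ℝ≥0∞ => Renyi.capacity α 𝒲) (Ioc 0 1)) ∧
    -- extended real valued convexity on `(1, ∞)`
    (∀ α₀ ∈ Ioi (1 : ℝ), ∀ α₁ ∈ Ioi (1 : ℝ), ∀ a b : ℝ, 0 ≤ a → 0 ≤ b → a + b = 1 →
      ((a * α₀ + b * α₁ - 1 : ℝ) : EReal) *
          Renyi.capacity (ENNReal.ofReal (a * α₀ + b * α₁)) 𝒲 ≤
        (a : EReal) * (((α₀ - 1 : ℝ) : EReal) * Renyi.capacity (ENNReal.ofReal α₀) 𝒲) +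
        (b : EReal) * (((α₁ - 1 : ℝ) : EReal) * Renyi.capacity (ENNReal.ofReal α₁) 𝒲)) ∧
    -- finiteness at one order in `(0, 1)` gives finiteness on `[0, 1)`
    (∀ θ ∈ Ioo (0 : ℝ≥0∞) 1, Renyi.capacity θ 𝒲 < ⊤ →
      ∀ α ∈ Ico (0 : ℝ≥0∞) 1, ∃ r : ℝ, Renyi.capacity α 𝒲 = r) ∧
    -- finiteness at an order `θ` gives continuity on `(0, θ]`
    (∀ θ ∈ Ioc (0 : ℝ≥0∞) ∞, Renyi.capacity θ 𝒲 < ⊤ →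
      MonotoneOn (fun α : ℝ≥0∞ => Renyi.capacity α 𝒲) (Ioc 0 θ) ∧
      ContinuousOn (fun α : ℝ≥0∞ => Renyi.capacity α 𝒲) (Ioc 0 θ)) ∧
    -- uniform approximation by finite subsets
    (∀ θ ∈ Ioc (0 : ℝ≥0∞) ∞, Renyi.capacity θ 𝒲 < ⊤ → ∀ ε : ℝ, 0 < ε →
      ∃ 𝒲' ⊆ 𝒲, 𝒲'.Finite ∧ ∀ α ∈ Icc (ENNReal.ofReal ε) θ,
        Renyi.capacity α 𝒲 - (ε : EReal) < Renyi.capacity α 𝒲') ∧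
    -- the dichotomy
    (ContinuousOn (fun α : ℝ≥0∞ => Renyi.capacity α 𝒲) (Ioc 0 ∞) ∨
      ∃ φ ∈ Ico (1 : ℝ≥0∞) ∞,
        (∃ M : ℝ, ∀ α ∈ Ioc 0 φ, Renyi.capacity α 𝒲 ≤ M) ∧
        ContinuousOn (fun α : ℝ≥0∞ => Renyi.capacity α 𝒲) (Ioc 0 φ) ∧
        (∀ α ∈ Ioc φ ∞, Renyi.capacity α 𝒲 = ⊤) ∧
        (∀ α ∈ Ioc (0 : ℝ≥0∞) ∞, α ≠ φ →
          ContinuousAt (fun α : ℝ≥0∞ => Renyi.capacity α 𝒲) α) ∧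
        ¬ ContinuousAt (fun α : ℝ≥0∞ => Renyi.capacity α 𝒲) φ) := by
  refine ⟨⟨Renyi.capacity_mono, Renyi.lowerSemicontinuous_capacity⟩,
    Renyi.exists_countable_capacity_eq 𝒲,
    ⟨Renyi.antitoneOn_mul_capacity h𝒲, Renyi.continuousOn_mul_capacity h𝒲,
      Renyi.continuousOn_capacity_Ioc_one h𝒲⟩,
    fun α₀ h₀ α₁ h₁ a b ha hb hab => Renyi.sub_one_mul_capacity_le h𝒲 h₀ h₁ ha hb hab,
    fun θ hθ hfin α hα => ?_,
    fun θ _ hfin => ⟨Renyi.capacity_mono.monotoneOn _,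
      Renyi.continuousOn_capacity_of_lt_top h𝒲 hfin⟩,
    fun θ _ hfin ε hε => Renyi.exists_finite_capacity_gt h𝒲 hfin hε,
    Renyi.continuousOn_or_exists_discontinuity h𝒲⟩
  obtain ⟨r, -, hr⟩ := Renyi.exists_capacity_eq_coe h𝒲
    (Renyi.capacity_lt_top_of_lt_one h𝒲 hθ.1 hfin hα.2)
  exact ⟨r, hr⟩
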